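/- Let $\mu$ be a probability measure on $\mathbb{R}$ and $a<b$ reals with $b-a>1$, $\mathrm{Supp}(\mu)\subset[a,b]$ and $\{a,b\}\subset\mathrm{Supp}(\mu)$. Assume that $\mu$ is the weak limit, as $n\to\infty$, of $\frac1n\sum_{i=1}^n\delta_{x^{(n)}_i/n}$ for some $x^{(n)}\in\mathbb{Z}^n$ with $x^{(n)}_1>\dots>x^{(n)}_n$. (Then $\mu\le\lambda$, where $\lambda$ is Lebesgue measure.) Let $C(w)=\int_a^b\frac{\mu[dx]}{w-x}$ for $w\in\mathbb{C}\setminus\mathrm{Supp}(\mu)$. Consider the shape of all $(\chi,\eta)\in[a,b]\times[0,1]$ with $b\ge\chi\ge\chi+\eta-1\ge a$. For $(\chi,\eta)$ in it, let $$f'_{(\chi,\eta)}(w)=\int_\chi^b\frac{\mu[dx]}{w-x}-\int_{\chi+\eta-1}^{\chi}\frac{(\lambda-\mu)[dx]}{w-x}+\int_a^{\chi+\eta-1}\frac{\mu[dx]}{w-x},$$ an analytic function on $\mathbb{C}\setminus\big(\mathrm{Supp}(\mu|_{[\chi,b]})\cup\mathrm{Supp}((\lambda-\mu)|_{[\chi+\eta-1,\chi]})\cup\mathrm{Supp}(\mu|_{[a,\chi+\eta-1]})\big)$;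 roots of $f'_{(\chi,\eta)}$ are roots in this domain. Define the following sets of points $(\chi,\eta)$ of the shape, writing $f'=f'_{(\chi,\eta)}$: * $\mathcal{E}_\mu$: $f'$ has a repeated root in $\mathbb{R}\setminus[\chi+\eta-1,\chi]$; * $\mathcal{E}_{\lambda-\mu}$: $f'$ has a repeated root in $(\chi+\eta-1,\chi)$; * $\mathcal{E}_0$: $\eta=1$ and $f'$ has a root at $\chi$; * $\mathcal{E}_1$: $\eta<1$ and $f'$ has a root at $\chi$; * $\mathcal{E}_2$: $\eta<1$ and $f'$ has a root at $\chi+\eta-1$. Define also the following subsets of $\mathbb{R}$: * $R_\mu=\{t\in\mathbb{R}\setminus\mathrm{Supp}(\mu):C(t)\ne0\}$, $\;R_0=\{t\in\mathbb{R}\setminus\mathrm{Supp}(\mu):C(t)=0\}$, $\;R_{\lambda-\mu}=\mathbb{R}\setminus\mathrm{Supp}(\lambda-\mu)$; * $R_1$ (resp. $R_2$): the set of $t\in\partial(\mathbb{R}\setminus\mathrm{Supp}(\mu))\cap\partial(\mathbb{R}\setminus\mathrm{Supp}(\lambda-\mu))$ for which there is an interval $I=(t_2,t_1)\ni t$ with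 $(t,t_1)\subset\mathbb{R}\setminus\mathrm{Supp}(\mu)$ and $(t_2,t)\subset\mathbb{R}\setminus\mathrm{Supp}(\lambda-\mu)$ (resp. $(t,t_1)\subset\mathbb{R}\setminus\mathrm{Supp}(\lambda-\mu)$ and $(t_2,t)\subset\mathbb{R}\setminus\mathrm{Supp}(\mu)$); * $R=R_\mu\cup R_{\lambda-\mu}\cup R_0\cup R_1\cup R_2$. For $t\in R_{\lambda-\mu}$ fix any interval $I=(t_2,t_1)\ni t$ with $I\subset\mathbb{R}\setminus\mathrm{Supp}(\lambda-\mu)$, and for $t\in R_1\cup R_2$ any interval $I$ as above; put $C_I(s)=\int_{[a,b]\setminus I}\frac{\mu[dx]}{s-x}$ (the values below do not depend on $I$). The edge point $(\chi_{\mathcal E}(t),\eta_{\mathcal E}(t))$ of $t\in R$ is * $\Big(t+\dfrac{e^{C(t)}-1}{e^{C(t)}C'(t)},\;1+\dfrac{(e^{C(t)}-1)^2}{e^{C(t)}C'(t)}\Big)$ for $t\in R_\mu\cup R_0\cup R_{\lambda-\mu}$, where for $t\in R_{\lambda-\mu}$ the symbols $e^{C(t)}$ and $C'(t)$ denote the values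 of the analytic extensions, $e^{C(t)}=e^{C_I(t)}\frac{t-t_2}{t-t_1}$ and $C'(t)=C_I'(t)-\frac1{t-t_1}+\frac1{t-t_2}$; * $\big(t,\;1-e^{C_I(t)}(t-t_2)\big)$ for $t\in R_1$; * $\big(t-e^{-C_I(t)}(t-t_1),\;1+e^{-C_I(t)}(t-t_1)\big)$ for $t\in R_2$. Let $t\in R$ and $f'_t=f'_{(\chi_{\mathcal E}(t),\eta_{\mathcal E}(t))}$. Then: (a) $(\chi_{\mathcal E}(t),\eta_{\mathcal E}(t))\in\mathcal{E}_\mu$ if and only if $t\in R_\mu$; in this case $t$ is a root of $f'_t$ of multiplicity $2$ or $3$. (b) $(\chi_{\mathcal E}(t),\eta_{\mathcal E}(t))\in\mathcal{E}_{\lambda-\mu}$ if and only if $t\in R_{\lambda-\mu}$; in this case $t$ is a root of $f'_t$ of multiplicity $2$ or $3$. (c) $(\chi_{\mathcal E}(t),\eta_{\mathcal E}(t))\in\mathcal{E}_0$ if and only if $t\in R_0$; in this case $f'_t$ and $C$ are equal (they have the same domain $\mathbb{C}\setminus\mathrm{Supp}(\mu)$ and the same values), and $t$ is a root of $f'_t$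 of multiplicity $1$. (d) $(\chi_{\mathcal E}(t),\eta_{\mathcal E}(t))\in\mathcal{E}_1$ if and only if $t\in R_1$; in this case $t$ is a root of $f'_t$ of multiplicity $1$ or $2$. (e) $(\chi_{\mathcal E}(t),\eta_{\mathcal E}(t))\in\mathcal{E}_2$ if and only if $t\in R_2$; in this case $t$ is a root of $f'_t$ of multiplicity $1$ or $2$. -/

import Mathlib

open MeasureTheory Set Filter Topology

namespace GTEdge

noncomputable section

/-- The empirical distribution `(1/n) ∑ᵢ δ_{xᵢ/n}` of the rescaled particles `xᵢ/n`. -/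
def empirical (n : ℕ) (x : Fin n → ℤ) : Measure ℝ :=
  (n : NNReal)⁻¹ • ∑ i, Measure.dirac ((x i : ℝ) / (n : ℝ))

/-- The standing hypothesis on the limiting measure: `Supp μ ⊆ [a,b]`, `b - a > 1`,
`{a,b} ⊆ Supp μ`, and `μ` is the weak limit of the empirical distributions of strictly
decreasing integer configurations `x⁽ⁿ⁾ ∈ ℤⁿ`, rescaled by `1/n`. -/
structure IsLimitMeasure (μ : Measure ℝ) (a b : ℝ) (x : (n : ℕ) → Fin n → ℤ) : Prop where
  support_subset : μ.support ⊆ Icc a b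
  one_lt : 1 < b - a
  left_mem : a ∈ μ.support
  right_mem : b ∈ μ.support
  strictAnti : ∀ n, StrictAnti (x n)
  weak_limit : ∀ φ : BoundedContinuousFunction ℝ ℝ,
    Tendsto (fun n => ∫ y, φ y ∂(empirical n (x n))) atTop (𝓝 (∫ y, φ y ∂μ))

/-- The measure `λ - μ`, where `λ` is Lebesgue measure. -/
def co (μ : Measure ℝ) : Measure ℝ := volume - μ

/-- `∫_s ν[dx] / (w - x)` for complex `w`. -/
def cauchyOn (ν : Measure ℝ) (s : Set ℝ) (w : ℂ) : ℂ := ∫ x in s, 1 / (w - (x : ℂ)) ∂ν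

/-- `∫_s ν[dx] / (t - x)` for real `t`. -/
def realCauchyOn (ν : Measure ℝ) (s : Set ℝ) (t : ℝ) : ℝ := ∫ x in s, 1 / (t - x) ∂ν

/-- The Cauchy transform `C(w) = ∫_a^b μ[dx] / (w - x)`, on `ℂ \ Supp μ`. -/
def C (μ : Measure ℝ) (a b : ℝ) (w : ℂ) : ℂ := cauchyOn μ (Icc a b) w

/-- The set of `(χ,η) ∈ [a,b] × [0,1]` with `b ≥ χ ≥ χ + η - 1 ≥ a`. -/
def Shape (a b : ℝ) : Set (ℝ × ℝ) :=
  {p | p.1 ∈ Icc a b ∧ p.2 ∈ Icc (0 : ℝ) 1 ∧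
    p.1 ≤ b ∧ p.1 + p.2 - 1 ≤ p.1 ∧ a ≤ p.1 + p.2 - 1}

/-- The function `f'_{(χ,η)}`, for `p = (χ,η)`; its domain is the complement of `singSet`. -/
def fDer (μ : Measure ℝ) (a b : ℝ) (p : ℝ × ℝ) (w : ℂ) : ℂ :=
  cauchyOn μ (Icc p.1 b) w - cauchyOn (co μ) (Icc (p.1 + p.2 - 1) p.1) w
    + cauchyOn μ (Icc a (p.1 + p.2 - 1)) w

/-- The closed set `Supp(μ|[χ,b]) ∪ Supp((λ-μ)|[χ+η-1,χ]) ∪ Supp(μ|[a,χ+η-1])` of reals. -/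
def singSet (μ : Measure ℝ) (a b : ℝ) (p : ℝ × ℝ) : Set ℝ :=
  (μ.restrict (Icc p.1 b)).support
    ∪ ((co μ).restrict (Icc (p.1 + p.2 - 1) p.1)).support
    ∪ (μ.restrict (Icc a (p.1 + p.2 - 1))).support

/-- The real `t` is in the domain of `f'_p` and is a root of it. -/
def IsRootAt (μ : Measure ℝ) (a b : ℝ) (p : ℝ × ℝ) (t : ℝ) : Prop :=
  t ∉ singSet μ a b p ∧ fDer μ a b p (t : ℂ) = 0

/-- The real `t` is in the domain of `f'_p` and is a repeated root of it. -/
def IsRepeatedRootAt (μ : Measure ℝ) (a b : ℝ) (p : ℝ × ℝ) (t : ℝ) : Prop :=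
  t ∉ singSet μ a b p ∧ 2 ≤ analyticOrderAt (fDer μ a b p) (t : ℂ)

/-- The real `t` is in the domain of `f'_p` and is a root of it of multiplicity `m`. -/
def IsRootOfMult (μ : Measure ℝ) (a b : ℝ) (p : ℝ × ℝ) (t : ℝ) (m : ℕ) : Prop :=
  t ∉ singSet μ a b p ∧ analyticOrderAt (fDer μ a b p) (t : ℂ) = m

/-- `ℰ_μ` -/
def Emu (μ : Measure ℝ) (a b : ℝ) : Set (ℝ × ℝ) :=
  {p | p ∈ Shape a b ∧ ∃ s : ℝ, s ∉ Icc (p.1 + p.2 - 1) p.1 ∧ IsRepeatedRootAt μ a b p s}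

/-- `ℰ_{λ-μ}` -/
def Eco (μ : Measure ℝ) (a b : ℝ) : Set (ℝ × ℝ) :=
  {p | p ∈ Shape a b ∧ ∃ s : ℝ, s ∈ Ioo (p.1 + p.2 - 1) p.1 ∧ IsRepeatedRootAt μ a b p s}

/-- `ℰ_0` -/
def E0 (μ : Measure ℝ) (a b : ℝ) : Set (ℝ × ℝ) :=
  {p | p ∈ Shape a b ∧ p.2 = 1 ∧ IsRootAt μ a b p p.1}

/-- `ℰ_1` -/
def E1 (μ : Measure ℝ) (a b : ℝ) : Set (ℝ × ℝ) :=
  {p | p ∈ Shape a b ∧ p.2 < 1 ∧ IsRootAt μ a b p p.1}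

/-- `ℰ_2` -/
def E2 (μ : Measure ℝ) (a b : ℝ) : Set (ℝ × ℝ) :=
  {p | p ∈ Shape a b ∧ p.2 < 1 ∧ IsRootAt μ a b p (p.1 + p.2 - 1)}

/-- `R_μ` -/
def Rmu (μ : Measure ℝ) (a b : ℝ) : Set ℝ := {t | t ∉ μ.support ∧ C μ a b (t : ℂ) ≠ 0}

/-- `R_{λ-μ}` -/
def Rco (μ : Measure ℝ) : Set ℝ := {t | t ∉ (co μ).support}

/-- `R_0` -/
def R0 (μ : Measure ℝ) (a b : ℝ) : Set ℝ := {t | t ∉ μ.support ∧ C μ a b (t : ℂ) = 0}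

/-- `I = (t₂, t₁)`, stored as the pair `(t₂, t₁)`, is an interval around `t` on which `λ - μ`
vanishes. -/
def AdmCo (μ : Measure ℝ) (t : ℝ) (I : ℝ × ℝ) : Prop :=
  t ∈ Ioo I.1 I.2 ∧ Ioo I.1 I.2 ⊆ (co μ).supportᶜ

/-- `I = (t₂, t₁)` contains `t`, with `(t, t₁) ⊆ ℝ \ Supp μ` and
`(t₂, t) ⊆ ℝ \ Supp(λ - μ)`. -/
def Adm1 (μ : Measure ℝ) (t : ℝ) (I : ℝ × ℝ) : Prop :=
  t ∈ Ioo I.1 I.2 ∧ Ioo t I.2 ⊆ μ.supportᶜ ∧ Ioo I.1 t ⊆ (co μ).supportᶜ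

/-- `I = (t₂, t₁)` contains `t`, with `(t, t₁) ⊆ ℝ \ Supp(λ - μ)` and
`(t₂, t) ⊆ ℝ \ Supp μ`. -/
def Adm2 (μ : Measure ℝ) (t : ℝ) (I : ℝ × ℝ) : Prop :=
  t ∈ Ioo I.1 I.2 ∧ Ioo t I.2 ⊆ (co μ).supportᶜ ∧ Ioo I.1 t ⊆ μ.supportᶜ

/-- `R_1` -/
def R1 (μ : Measure ℝ) : Set ℝ :=
  {t | t ∈ frontier (μ.supportᶜ) ∩ frontier ((co μ).supportᶜ) ∧ ∃ I : ℝ × ℝ, Adm1 μ t I}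

/-- `R_2` -/
def R2 (μ : Measure ℝ) : Set ℝ :=
  {t | t ∈ frontier (μ.supportᶜ) ∩ frontier ((co μ).supportᶜ) ∧ ∃ I : ℝ × ℝ, Adm2 μ t I}

/-- The parameter set `R = R_μ ∪ R_{λ-μ} ∪ R_0 ∪ R_1 ∪ R_2` of the edge curve. -/
def R (μ : Measure ℝ) (a b : ℝ) : Set ℝ := Rmu μ a b ∪ Rco μ ∪ R0 μ a b ∪ R1 μ ∪ R2 μ

/-- A choice of an admissible interval `I t = (t₂, t₁)` for every `t` that needs one. The edge
curve below does not depend on it. -/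
def AdmissibleChoice (μ : Measure ℝ) (I : ℝ → ℝ × ℝ) : Prop :=
  (∀ t ∈ Rco μ, AdmCo μ t (I t)) ∧ (∀ t ∈ R1 μ, Adm1 μ t (I t)) ∧ (∀ t ∈ R2 μ, Adm2 μ t (I t))

/-- `C_I(s) = ∫_{[a,b] \ I} μ[dx] / (s - x)` for real `s`, where `I = (t₂, t₁)`. -/
def CI (μ : Measure ℝ) (a b : ℝ) (I : ℝ × ℝ) (s : ℝ) : ℝ :=
  realCauchyOn μ (Icc a b \ Ioo I.1 I.2) s

open Classical in
/-- The value at a real `t ∉ Supp μ` or `t ∉ Supp(λ - μ)` of the analytic extension of `e^C`. -/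
def expC (μ : Measure ℝ) (a b : ℝ) (I : ℝ → ℝ × ℝ) (t : ℝ) : ℝ :=
  if t ∉ μ.support then Real.exp (realCauchyOn μ (Icc a b) t)
  else Real.exp (CI μ a b (I t) t) * ((t - (I t).1) / (t - (I t).2))

open Classical in
/-- The value at a real `t ∉ Supp μ` or `t ∉ Supp(λ - μ)` of the analytic extension of `C'`. -/
def derC (μ : Measure ℝ) (a b : ℝ) (I : ℝ → ℝ × ℝ) (t : ℝ) : ℝ :=
  if t ∉ μ.support then deriv (realCauchyOn μ (Icc a b)) t
  else deriv (CI μ a b (I t)) t - 1 / (t - (I t).2) + 1 / (t - (I t).1)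

open Classical in
/-- The edge curve `t ↦ (χ_ℰ(t), η_ℰ(t))`, `t ∈ R` (with the value `(0,0)` off `R`). -/
def edge (μ : Measure ℝ) (a b : ℝ) (I : ℝ → ℝ × ℝ) (t : ℝ) : ℝ × ℝ :=
  if t ∉ μ.support ∨ t ∉ (co μ).support then
    (t + (expC μ a b I t - 1) / (expC μ a b I t * derC μ a b I t),
      1 + (expC μ a b I t - 1) ^ 2 / (expC μ a b I t * derC μ a b I t))
  else if t ∈ R1 μ then
    (t, 1 - Real.exp (CI μ a b (I t) t) * (t - (I t).1))
  else if t ∈ R2 μ then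
    (t - Real.exp (-CI μ a b (I t) t) * (t - (I t).2),
      1 + Real.exp (-CI μ a b (I t) t) * (t - (I t).2))
  else (0, 0)

end

end GTEdge

/-! Write c = χ and d = χ + η - 1. Then f' is the Cauchy transform of P - N, where P is μ off (d, c)
and N is λ - μ on (d, c). The quadratic (x - c)(x - d) is positive P-a.e. and negative N-a.e., so
multiplied by any positive weight it has a strictly positive integral against P - N, provided it is
integrable. For weights built from inverse powers of t - x, partial fractions turn this into a
strict inequality between the moments ∫ (P - N)[dx] / (t - x)^k, which are the derivatives of f' at
t up to nonzero factors.

Call t critical if it is a root of f' that is repeated or equal to c or d. Positivity shows that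
there is at most one critical point (`SignPair.critical_unique`), that its multiplicity is bounded
(`SignPair.not_higher_moments`), and, with linear factors as well, that (χ, η) lies in the shape
(`IsLimitMeasure.shape_of_isCritical`). Each edge set asks for a critical point in a certain
position, so the position of the unique one decides membership (`IsLimitMeasure.mem_edge_sets_iff`).

It remains to see that t is critical for its own edge point. On each side of t the measure μ is
locally either zero or Lebesgue measure, and the edge point is chosen so that P - N vanishes near t.
The first two moments are then those of μ away from t plus explicit logarithms and inverses
(`LocalModel.mom_one`, `LocalModel.mom_two`). Their vanishing reads e^C = (t - d)/(t - c) and C' =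
1/(c - t) - 1/(d - t), whose solution is the rational edge formula. The signs of e^C - 1, e^C and C'
place t relative to d and c. For t in R_1 or R_2 one endpoint is t itself, and the first moment
alone gives the other. Throughout, μ ≤ λ, because distinct integers divided by n are at least 1/n
apart. -/

namespace GTEdge

/-! ### Domination of the limit measure by Lebesgue measure -/

/-- A continuous bump function, equal to `1` on `[u, v]` and to `0` off `(u - ε, v + ε)`. -/
noncomputable def bump (u v ε : ℝ) : BoundedContinuousFunction ℝ ℝ :=
  BoundedContinuousFunction.ofNormedAddCommGroup
    (fun y => max 0 (min 1 (min ((y - u) / ε + 1) ((v - y) / ε + 1)))) (by fun_prop) 1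
    (fun y => by
      rw [Real.norm_eq_abs, abs_of_nonneg (le_max_left _ _)]
      exact max_le zero_le_one (min_le_left _ _))

lemma bump_apply (u v ε y : ℝ) :
    bump u v ε y = max 0 (min 1 (min ((y - u) / ε + 1) ((v - y) / ε + 1))) := rfl

lemma bump_nonneg (u v ε y : ℝ) : 0 ≤ bump u v ε y := le_max_left _ _

lemma bump_le_one (u v ε y : ℝ) : bump u v ε y ≤ 1 :=
  max_le zero_le_one (min_le_left _ _)

lemma bump_eq_one {u v ε y : ℝ} (hε : 0 < ε) (hy : y ∈ Icc u v) : bump u v ε y = 1 := by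
  have h1 : 0 ≤ (y - u) / ε := div_nonneg (by linarith [hy.1]) hε.le
  have h2 : 0 ≤ (v - y) / ε := div_nonneg (by linarith [hy.2]) hε.le
  rw [bump_apply, min_eq_left (le_min (by linarith) (by linarith)), max_eq_right zero_le_one]

lemma bump_eq_zero {u v ε y : ℝ} (hε : 0 < ε) (hy : y ∉ Ioo (u - ε) (v + ε)) :
    bump u v ε y = 0 := by
  rw [bump_apply]
  apply max_eq_left
  rw [mem_Ioo, not_and_or, not_lt, not_lt] at hy
  refine (min_le_right _ _).trans ?_
  rcases hy with hy | hy
  · refine (min_le_left _ _).trans ?_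
    have : (y - u) / ε ≤ -1 := by rw [div_le_iff₀ hε]; linarith
    linarith
  · refine (min_le_right _ _).trans ?_
    have : (v - y) / ε ≤ -1 := by rw [div_le_iff₀ hε]; linarith
    linarith

lemma integral_empirical (n : ℕ) (x : Fin n → ℤ) (φ : BoundedContinuousFunction ℝ ℝ) :
    ∫ y, φ y ∂(empirical n x) = (n : ℝ)⁻¹ * ∑ i, φ ((x i : ℝ) / n) := by
  rw [empirical, integral_smul_nnreal_measure, integral_finsetSum_measure]
  · simp [NNReal.smul_def]
  · exact fun i _ => φ.integrable _

/-- Strict monotonicity makes the integers x i distinct, and those counted lie between n u and n v.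
-/
lemma card_rescaled_le {n : ℕ} (hn : 0 < n) {x : Fin n → ℤ} (hx : StrictAnti x) {u v : ℝ}
    (huv : u ≤ v) :
    ((Finset.univ.filter fun i => (x i : ℝ) / n ∈ Ioo u v).card : ℝ) ≤ n * (v - u) + 1 := by
  have hn' : (0 : ℝ) < n := by exact_mod_cast hn
  have h : (Finset.univ.filter fun i => (x i : ℝ) / n ∈ Ioo u v).card
      ≤ (Finset.Icc ⌈n * u⌉ ⌊n * v⌋).card := by
    refine Finset.card_le_card_of_injOn x ?_ hx.injective.injOn
    intro i hi
    simp only [Finset.coe_filter, Finset.mem_univ, true_and, mem_ofPred_eq, mem_Ioo] at hi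
    simp only [Finset.coe_Icc, mem_Icc]
    rw [lt_div_iff₀ hn', div_lt_iff₀ hn'] at hi
    exact ⟨Int.ceil_le.2 (by linarith), Int.le_floor.2 (by linarith)⟩
  rw [Int.card_Icc] at h
  have h2 : (((⌊n * v⌋ + 1 - ⌈n * u⌉).toNat : ℕ) : ℝ) ≤ n * (v - u) + 1 := by
    rcases le_total (⌊n * v⌋ + 1 - ⌈n * u⌉) 0 with h0 | h0
    · rw [Int.toNat_of_nonpos h0]
      have : 0 ≤ n * (v - u) := mul_nonneg hn'.le (by linarith)
      push_cast; linarith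
    · have : (((⌊n * v⌋ + 1 - ⌈n * u⌉).toNat : ℤ) : ℝ) = ((⌊n * v⌋ + 1 - ⌈n * u⌉ : ℤ) : ℝ) := by
        rw [Int.toNat_of_nonneg h0]
      rw [← Int.cast_natCast, this]
      push_cast
      linarith [Int.floor_le (n * v), Int.le_ceil (n * u)]
  exact le_trans (by exact_mod_cast h) h2

lemma integral_bump_empirical_le {n : ℕ} (hn : 0 < n) {x : Fin n → ℤ} (hx : StrictAnti x)
    {u v ε : ℝ} (huv : u ≤ v) (hε : 0 < ε) :
    ∫ y, bump u v ε y ∂(empirical n x) ≤ v - u + 2 * ε + 1 / n := by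
  have hn' : (0 : ℝ) < n := by exact_mod_cast hn
  have h1 : ∑ i, bump u v ε ((x i : ℝ) / n)
      ≤ ((Finset.univ.filter fun i => (x i : ℝ) / n ∈ Ioo (u - ε) (v + ε)).card : ℝ) := by
    rw [Finset.card_filter]
    push_cast
    refine Finset.sum_le_sum fun i _ => ?_
    split_ifs with h
    · exact bump_le_one _ _ _ _
    · rw [bump_eq_zero hε h]
  have h2 := h1.trans (card_rescaled_le hn hx (by linarith : u - ε ≤ v + ε))
  rw [integral_empirical, inv_mul_le_iff₀ hn']
  refine h2.trans (le_of_eq ?_)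
  field_simp
  ring

section

variable {μ : Measure ℝ} [IsProbabilityMeasure μ] {a b : ℝ} {x : (n : ℕ) → Fin n → ℤ}

/-- A bump dominating the indicator passes the counting bound to the weak limit. The 1/n error
vanishes, and the width of the bump is arbitrary. -/
lemma IsLimitMeasure.measureReal_Icc_le (hμ : IsLimitMeasure μ a b x) {u v : ℝ} (huv : u ≤ v) :
    μ.real (Icc u v) ≤ v - u := by
  refine le_of_forall_pos_le_add fun δ hδ => ?_
  have hε : 0 < δ / 2 := by linarith
  have h1 : ∫ y, bump u v (δ / 2) y ∂μ ≤ v - u + 2 * (δ / 2) + 0 := by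
    refine le_of_tendsto_of_tendsto (hμ.weak_limit _)
      (tendsto_const_nhds.add tendsto_one_div_atTop_nhds_zero_nat) ?_
    filter_upwards [eventually_gt_atTop 0] with n hn
    exact integral_bump_empirical_le hn (hμ.strictAnti n) huv hε
  have h2 : μ.real (Icc u v) ≤ ∫ y, bump u v (δ / 2) y ∂μ := by
    rw [← integral_indicator_one measurableSet_Icc]
    refine integral_mono ((integrable_const _).indicator measurableSet_Icc)
      ((bump u v (δ / 2)).integrable μ) fun y => ?_
    by_cases hy : y ∈ Icc u v
    · simp [hy, bump_eq_one hε hy]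
    · simp [hy, bump_nonneg]
  linarith

/-- The bound on intervals makes y minus the distribution function of μ monotone, hence a Stieltjes
function; its measure added to μ is Lebesgue measure. -/
lemma IsLimitMeasure.le_volume (hμ : IsLimitMeasure μ a b x) : μ ≤ volume := by
  have hcdf : ∀ {u v : ℝ}, u ≤ v →
      ProbabilityTheory.cdf μ v - ProbabilityTheory.cdf μ u ≤ v - u := by
    intro u v huv
    rw [ProbabilityTheory.cdf_eq_real, ProbabilityTheory.cdf_eq_real, ← measureReal_sdiff
      (Iic_subset_Iic.2 huv) measurableSet_Iic]
    refine le_trans (measureReal_mono ?_) (hμ.measureReal_Icc_le huv)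
    rintro y ⟨h1, h2⟩
    exact ⟨(not_le.1 h2).le, h1⟩
  let g : StieltjesFunction ℝ :=
    { toFun := fun y => y - ProbabilityTheory.cdf μ y
      mono' := fun u v huv => by
        have := hcdf huv
        change u - ProbabilityTheory.cdf μ u ≤ v - ProbabilityTheory.cdf μ v
        linarith
      right_continuous' := fun y =>
        continuousWithinAt_id.sub ((ProbabilityTheory.cdf μ).right_continuous y) }
  have h : ProbabilityTheory.cdf μ + g = StieltjesFunction.id := by
    ext y
    change ProbabilityTheory.cdf μ y + (y - ProbabilityTheory.cdf μ y) = y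
    ring
  have h2 := StieltjesFunction.measure_add (ProbabilityTheory.cdf μ) g
  rw [h, ProbabilityTheory.measure_cdf, ← Real.volume_eq_stieltjes_id] at h2
  rw [h2]
  exact Measure.le_add_right le_rfl

end

/-! ### Inverse-power integrals off the support -/

section Moments

variable {ρ : Measure ℝ}

lemma exists_forall_ae_le_norm_sub {w : ℂ} (hw : w ∉ Complex.ofReal '' ρ.support) :
    ∃ δ > 0, ∀ᵐ x : ℝ ∂ρ, δ ≤ ‖w - (x : ℂ)‖ := by
  have hc : IsClosed (Complex.ofReal '' ρ.support) :=
    Complex.isometry_ofReal.isClosedEmbedding.isClosedMap _ Measure.isClosed_support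
  obtain ⟨δ, hδ, h⟩ := Metric.isOpen_iff.1 hc.isOpen_compl w hw
  refine ⟨δ, hδ, ?_⟩
  filter_upwards [Measure.support_mem_ae (μ := ρ)] with x hx
  by_contra hlt
  refine h (a := (x : ℂ)) ?_ ⟨x, hx, rfl⟩
  rw [Metric.mem_ball, dist_comm, dist_eq_norm]
  exact not_le.1 hlt

lemma ofReal_notMem_image {t : ℝ} {s : Set ℝ} (ht : t ∉ s) : (t : ℂ) ∉ Complex.ofReal '' s := by
  rintro ⟨y, hy, h⟩
  exact ht (Complex.ofReal_injective h ▸ hy)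

lemma eventually_notMem_image_support {w : ℂ} (hw : w ∉ Complex.ofReal '' ρ.support) :
    ∀ᶠ z in 𝓝 w, z ∉ Complex.ofReal '' ρ.support :=
  (Complex.isometry_ofReal.isClosedEmbedding.isClosedMap _
    (Measure.isClosed_support (μ := ρ))).isOpen_compl.mem_nhds hw

lemma aestronglyMeasurable_inv_sub_pow (ρ : Measure ℝ) (w : ℂ) (k : ℕ) :
    AEStronglyMeasurable (fun x : ℝ => ((w - (x : ℂ)) ^ k)⁻¹) ρ :=
  (by fun_prop : Measurable fun x : ℝ => ((w - (x : ℂ)) ^ k)⁻¹).aestronglyMeasurable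

variable [IsFiniteMeasure ρ]

lemma integrable_inv_sub_pow {w : ℂ} (hw : w ∉ Complex.ofReal '' ρ.support) (k : ℕ) :
    Integrable (fun x : ℝ => ((w - (x : ℂ)) ^ k)⁻¹) ρ := by
  obtain ⟨δ, hδ, h⟩ := exists_forall_ae_le_norm_sub hw
  refine Integrable.of_bound (aestronglyMeasurable_inv_sub_pow ρ w k) (δ ^ k)⁻¹ ?_
  filter_upwards [h] with x hx
  rw [norm_inv, norm_pow]
  gcongr

lemma integrable_real_inv_sub_pow {t : ℝ} (ht : t ∉ ρ.support) (k : ℕ) :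
    Integrable (fun x : ℝ => ((t - x) ^ k)⁻¹) ρ := by
  have := (integrable_inv_sub_pow (ofReal_notMem_image ht) k).re
  refine this.congr (ae_of_all _ fun x => ?_)
  simp only [← Complex.ofReal_sub, ← Complex.ofReal_pow, ← Complex.ofReal_inv]
  rfl

/-- Differentiation under the integral: on the ball of half the distance to the support, the
derivatives are uniformly bounded. -/
lemma hasDerivAt_integral_inv_sub_pow {w : ℂ} (hw : w ∉ Complex.ofReal '' ρ.support) (k : ℕ) :
    HasDerivAt (fun z : ℂ => ∫ x : ℝ, ((z - (x : ℂ)) ^ k)⁻¹ ∂ρ)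
      (-(k : ℂ) * ∫ x : ℝ, ((w - (x : ℂ)) ^ (k + 1))⁻¹ ∂ρ) w := by
  obtain ⟨δ, hδ, h⟩ := exists_forall_ae_le_norm_sub hw
  have hb : ∀ᵐ x : ℝ ∂ρ, ∀ z ∈ Metric.ball w (δ / 2), δ / 2 ≤ ‖z - (x : ℂ)‖ := by
    filter_upwards [h] with x hx z hz
    rw [Metric.mem_ball, dist_comm, dist_eq_norm] at hz
    have := norm_sub_le_norm_sub_add_norm_sub w z (x : ℂ)
    linarith
  have key := (hasDerivAt_integral_of_dominated_loc_of_deriv_le (μ := ρ) (𝕜 := ℂ)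
    (F := fun z x => ((z - (x : ℂ)) ^ k)⁻¹)
    (F' := fun z x => -(k : ℂ) * ((z - (x : ℂ)) ^ (k + 1))⁻¹)
    (bound := fun _ => k * ((δ / 2) ^ (k + 1))⁻¹)
    (Metric.ball_mem_nhds w (half_pos hδ))
    (Eventually.of_forall fun z => aestronglyMeasurable_inv_sub_pow ρ z k)
    (integrable_inv_sub_pow hw k)
    ((aestronglyMeasurable_inv_sub_pow ρ w (k + 1)).const_mul _)
    (by
      filter_upwards [hb] with x hx z hz
      rw [norm_mul, norm_neg, Complex.norm_natCast, norm_inv, norm_pow]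
      gcongr
      exact hx z hz)
    (integrable_const _)
    (by
      filter_upwards [hb] with x hx z hz
      have hne : z - (x : ℂ) ≠ 0 := norm_pos_iff.1 ((half_pos hδ).trans_le (hx z hz))
      refine ((((hasDerivAt_id' z).sub_const (x : ℂ)).fun_pow k).fun_inv
        (pow_ne_zero k hne)).congr_deriv ?_
      -- The derivative of the power involves the truncated k - 1, so k = 0, where both sides
      -- vanish, is separate.
      rcases k with _ | k
      · simp
      · simp only [Nat.add_sub_cancel]
        field_simp
        ring)).2
  rwa [integral_const_mul] at key

lemma hasDerivAt_real_integral_inv_sub {t : ℝ} (ht : t ∉ ρ.support) :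
    HasDerivAt (fun s : ℝ => ∫ x : ℝ, 1 / (s - x) ∂ρ) (-∫ x : ℝ, ((t - x) ^ 2)⁻¹ ∂ρ) t := by
  have h := (hasDerivAt_integral_inv_sub_pow (ofReal_notMem_image ht) 1).real_of_complex
  have e1 : ∀ (s : ℝ) (k : ℕ), ∫ x : ℝ, (((s : ℂ) - (x : ℂ)) ^ k)⁻¹ ∂ρ
      = ((∫ x : ℝ, ((s - x) ^ k)⁻¹ ∂ρ : ℝ) : ℂ) := by
    intro s k
    rw [← integral_complex_ofReal]
    simp
  simp only [e1] at h
  convert h using 1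
  · ext s
    simp
  · simp [-Complex.ofReal_neg]

end Moments

/-! ### Order of vanishing through moments -/

/-- The moment `∫ (P - N)[dx] / (t - x) ^ k` of a difference of measures. -/
noncomputable def mom (P N : Measure ℝ) (t : ℝ) (k : ℕ) : ℝ :=
  ∫ x, ((t - x) ^ k)⁻¹ ∂P - ∫ x, ((t - x) ^ k)⁻¹ ∂N

section Order

variable {P N : Measure ℝ} [IsFiniteMeasure P] [IsFiniteMeasure N]

lemma iteratedDeriv_integral_inv_sub {w : ℂ} (hP : w ∉ Complex.ofReal '' P.support)
    (hN : w ∉ Complex.ofReal '' N.support) (k : ℕ) :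
    iteratedDeriv k (fun z : ℂ => ∫ x : ℝ, ((z - (x : ℂ)) ^ 1)⁻¹ ∂P
        - ∫ x : ℝ, ((z - (x : ℂ)) ^ 1)⁻¹ ∂N) =ᶠ[𝓝 w]
      fun z => (-1) ^ k * (k.factorial : ℂ) * (∫ x : ℝ, ((z - (x : ℂ)) ^ (k + 1))⁻¹ ∂P
        - ∫ x : ℝ, ((z - (x : ℂ)) ^ (k + 1))⁻¹ ∂N) := by
  induction k with
  | zero => simp
  | succ k ih =>
    rw [iteratedDeriv_succ]
    refine ih.deriv.trans ?_
    filter_upwards [eventually_notMem_image_support hP, eventually_notMem_image_support hN]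
      with z hzP hzN
    refine (((hasDerivAt_integral_inv_sub_pow hzP (k + 1)).fun_sub
      (hasDerivAt_integral_inv_sub_pow hzN (k + 1))).const_mul _).deriv.trans ?_
    rw [Nat.factorial_succ]
    push_cast
    ring

lemma analyticAt_integral_inv_sub {w : ℂ} (hP : w ∉ Complex.ofReal '' P.support)
    (hN : w ∉ Complex.ofReal '' N.support) :
    AnalyticAt ℂ (fun z : ℂ => ∫ x : ℝ, ((z - (x : ℂ)) ^ 1)⁻¹ ∂P
        - ∫ x : ℝ, ((z - (x : ℂ)) ^ 1)⁻¹ ∂N) w := by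
  rw [Complex.analyticAt_iff_eventually_differentiableAt]
  filter_upwards [eventually_notMem_image_support hP, eventually_notMem_image_support hN]
    with z hzP hzN
  exact ((hasDerivAt_integral_inv_sub_pow hzP 1).sub
      (hasDerivAt_integral_inv_sub_pow hzN 1)).differentiableAt

lemma integral_complex_sub_eq_mom (P N : Measure ℝ) (t : ℝ) (k : ℕ) :
    ∫ x : ℝ, (((t : ℂ) - (x : ℂ)) ^ k)⁻¹ ∂P - ∫ x : ℝ, (((t : ℂ) - (x : ℂ)) ^ k)⁻¹ ∂N
      = (mom P N t k : ℂ) := by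
  rw [mom, Complex.ofReal_sub, ← integral_complex_ofReal, ← integral_complex_ofReal]
  simp

/-- The k-th derivative at t is (-1)^k k! times the moment of order k + 1, so multiplicities become
statements about moments. -/
lemma le_analyticOrderAt_integral_inv_sub_iff {t : ℝ} (hP : t ∉ P.support) (hN : t ∉ N.support)
    (n : ℕ) :
    (n : ℕ∞) ≤ analyticOrderAt (fun z : ℂ => ∫ x : ℝ, ((z - (x : ℂ)) ^ 1)⁻¹ ∂P
        - ∫ x : ℝ, ((z - (x : ℂ)) ^ 1)⁻¹ ∂N) t ↔ ∀ k < n, mom P N t (k + 1) = 0 := by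
  have hP' := ofReal_notMem_image hP
  have hN' := ofReal_notMem_image hN
  rw [natCast_le_analyticOrderAt_iff_iteratedDeriv_eq_zero (analyticAt_integral_inv_sub hP' hN')]
  refine forall₂_congr fun k _ => ?_
  rw [(iteratedDeriv_integral_inv_sub hP' hN' k).self_of_nhds]
  beta_reduce
  rw [integral_complex_sub_eq_mom]
  simp [Nat.factorial_ne_zero]

end Order

/-! ### Positivity for a difference of measures -/

/-- `f` is integrable for `P` and for `N`, and `∫ f d(P - N) = v`. -/
structure HasDiffIntegral (P N : Measure ℝ) (f : ℝ → ℝ) (v : ℝ) : Prop where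
  intP : Integrable f P
  intN : Integrable f N
  eq : ∫ x, f x ∂P - ∫ x, f x ∂N = v

namespace HasDiffIntegral

variable {P N : Measure ℝ} {f g : ℝ → ℝ} {v w : ℝ}

lemma add (hf : HasDiffIntegral P N f v) (hg : HasDiffIntegral P N g w) :
    HasDiffIntegral P N (fun x => f x + g x) (v + w) :=
  ⟨hf.intP.add hg.intP, hf.intN.add hg.intN, by
    rw [integral_add hf.intP hg.intP, integral_add hf.intN hg.intN, ← hf.eq, ← hg.eq]; ring⟩

lemma const_mul (hf : HasDiffIntegral P N f v) (r : ℝ) :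
    HasDiffIntegral P N (fun x => r * f x) (r * v) :=
  ⟨hf.intP.const_mul r, hf.intN.const_mul r, by
    rw [integral_const_mul, integral_const_mul, ← hf.eq]; ring⟩

lemma congr (hf : HasDiffIntegral P N f v) (hP : f =ᵐ[P] g) (hN : f =ᵐ[N] g) :
    HasDiffIntegral P N g v :=
  ⟨hf.intP.congr hP, hf.intN.congr hN, by
    rw [← integral_congr_ae hP, ← integral_congr_ae hN, hf.eq]⟩

lemma of_mom [IsFiniteMeasure P] [IsFiniteMeasure N] {t : ℝ} (hP : t ∉ P.support)
    (hN : t ∉ N.support) (k : ℕ) :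
    HasDiffIntegral P N (fun x => ((t - x) ^ k)⁻¹) (mom P N t k) :=
  ⟨integrable_real_inv_sub_pow hP k, integrable_real_inv_sub_pow hN k, rfl⟩

end HasDiffIntegral

lemma integral_pos_of_ae_pos {ρ : Measure ℝ} (hρ : ρ ≠ 0) {f : ℝ → ℝ} (hf : Integrable f ρ)
    (hpos : ∀ᵐ x ∂ρ, 0 < f x) : 0 < ∫ x, f x ∂ρ := by
  rw [integral_pos_iff_support_of_nonneg_ae (hpos.mono fun x hx => hx.le) hf]
  refine pos_iff_ne_zero.2 fun h0 => hρ ?_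
  rw [← ae_eq_bot, ← Filter.empty_mem_iff_bot]
  filter_upwards [hpos, measure_eq_zero_iff_ae_notMem.1 h0] with x h1 h2
  exact h2 h1.ne'

lemma HasDiffIntegral.pos {P N : Measure ℝ} (hne : P ≠ 0 ∨ N ≠ 0) {f : ℝ → ℝ} {v : ℝ}
    (hf : HasDiffIntegral P N f v) (hP : ∀ᵐ x ∂P, 0 < f x) (hN : ∀ᵐ x ∂N, f x < 0) : 0 < v := by
  have hneg : ∫ x, f x ∂N = -∫ x, -f x ∂N := by rw [integral_neg, neg_neg]
  have h1 : 0 ≤ ∫ x, f x ∂P := integral_nonneg_of_ae (hP.mono fun x hx => hx.le)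
  have h2 : 0 ≤ ∫ x, -f x ∂N :=
    integral_nonneg_of_ae (hN.mono fun x hx => neg_nonneg.2 hx.le)
  rw [← hf.eq, hneg]
  rcases hne with h | h
  · have := integral_pos_of_ae_pos h hf.intP hP
    linarith
  · have := integral_pos_of_ae_pos h hf.intN.neg (hN.mono fun x hx => neg_pos.2 hx)
    simp only [Pi.neg_apply] at this
    linarith

/-- Finite measures `P` and `N`, not both zero, with `P` living off `[d, c]` and `N` in `(d, c)`. -/
structure SignPair (P N : Measure ℝ) (c d : ℝ) : Prop where
  finP : IsFiniteMeasure P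
  finN : IsFiniteMeasure N
  aeP : ∀ᵐ x ∂P, x < d ∨ c < x
  aeN : ∀ᵐ x ∂N, d < x ∧ x < c
  ne_zero : P ≠ 0 ∨ N ≠ 0
  le : d ≤ c

/-- `t` is a root of `∫ (P - N)[dx] / (t - x)`, and a repeated one unless `t ∈ {c, d}`. -/
structure IsCritical (P N : Measure ℝ) (c d t : ℝ) : Prop where
  offP : t ∉ P.support
  offN : t ∉ N.support
  mom_one : mom P N t 1 = 0
  mom_two : (t - c) * (t - d) * mom P N t 2 = 0

lemma ae_ne_of_notMem_support {ρ : Measure ℝ} {t : ℝ} (ht : t ∉ ρ.support) :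
    ∀ᵐ x ∂ρ, t - x ≠ 0 := by
  filter_upwards [Measure.support_mem_ae (μ := ρ)] with x hx h
  exact ht (sub_eq_zero.1 h ▸ hx)

namespace SignPair

variable {P N : Measure ℝ} {c d t s : ℝ}

/-- The quadratic (x - c)(x - d) has exactly the sign of P - N; every estimate below with a
quadratic factor is an instance of this. -/
lemma pos (h : SignPair P N c d) {g : ℝ → ℝ} {v : ℝ}
    (hg : HasDiffIntegral P N (fun x => (x - c) * (x - d) * g x) v)
    (hP : ∀ᵐ x ∂P, 0 < g x) (hN : ∀ᵐ x ∂N, 0 < g x) : 0 < v := by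
  refine hg.pos h.ne_zero ?_ ?_
  · filter_upwards [h.aeP, hP] with x hx hgx
    refine mul_pos ?_ hgx
    rcases hx with hx | hx
    · exact mul_pos_of_neg_of_neg (by linarith [h.le]) (by linarith)
    · exact mul_pos (by linarith) (by linarith [h.le])
  · filter_upwards [h.aeN, hN] with x hx hgx
    exact mul_neg_of_neg_of_pos (mul_neg_of_neg_of_pos (by linarith) (by linarith)) hgx

/-- Expansion of the quadratic at t: (x - c)(x - d) = (t - x)^2 - (2t - c - d)(t - x) + (t - c)(t -
d). -/
lemma hasDiffIntegral_quadratic (h : SignPair P N c d) (hP : t ∉ P.support) (hN : t ∉ N.support)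
    (k : ℕ) : HasDiffIntegral P N (fun x => (x - c) * (x - d) * ((t - x) ^ (k + 2))⁻¹)
      (mom P N t k + -(2 * t - c - d) * mom P N t (k + 1)
        + (t - c) * (t - d) * mom P N t (k + 2)) := by
  have := h.finP
  have := h.finN
  have key : ∀ x, t - x ≠ 0 → ((t - x) ^ k)⁻¹ + -(2 * t - c - d) * ((t - x) ^ (k + 1))⁻¹
      + (t - c) * (t - d) * ((t - x) ^ (k + 2))⁻¹
        = (x - c) * (x - d) * ((t - x) ^ (k + 2))⁻¹ := by
    intro x hx
    field_simp
    ring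
  refine (((HasDiffIntegral.of_mom hP hN k).add ((HasDiffIntegral.of_mom hP hN (k + 1)).const_mul
    (-(2 * t - c - d)))).add ((HasDiffIntegral.of_mom hP hN (k + 2)).const_mul
      ((t - c) * (t - d)))).congr ?_ ?_
  · filter_upwards [ae_ne_of_notMem_support hP] with x hx using key x hx
  · filter_upwards [ae_ne_of_notMem_support hN] with x hx using key x hx

lemma hasDiffIntegral_linear (h : SignPair P N c d) (hP : t ∉ P.support) (hN : t ∉ N.support)
    (e : ℝ) : HasDiffIntegral P N (fun x => (e - x) * ((t - x) ^ 2)⁻¹)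
      (mom P N t 1 + -(t - e) * mom P N t 2) := by
  have := h.finP
  have := h.finN
  have key : ∀ x, t - x ≠ 0 → ((t - x) ^ 1)⁻¹ + -(t - e) * ((t - x) ^ 2)⁻¹
        = (e - x) * ((t - x) ^ 2)⁻¹ := by
    intro x hx
    field_simp
    ring
  refine ((HasDiffIntegral.of_mom hP hN 1).add ((HasDiffIntegral.of_mom hP hN 2).const_mul
    (-(t - e)))).congr ?_ ?_
  · filter_upwards [ae_ne_of_notMem_support hP] with x hx using key x hx
  · filter_upwards [ae_ne_of_notMem_support hN] with x hx using key x hx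

lemma ae_pow_pos (hP : t ∉ P.support) {k : ℕ} (hk : Even k) :
    ∀ᵐ x ∂P, 0 < ((t - x) ^ k)⁻¹ := by
  filter_upwards [ae_ne_of_notMem_support hP] with x hx
  exact inv_pos.2 (hk.pow_pos hx)

/-- The order of vanishing at a critical point is bounded. -/
lemma not_higher_moments (h : SignPair P N c d) (hP : t ∉ P.support) (hN : t ∉ N.support)
    (h2 : mom P N t 2 = 0) (h3 : (2 * t - c - d) * mom P N t 3 = 0)
    (h4 : (t - c) * (t - d) * mom P N t 4 = 0) : False := by
  -- With weight (t - x)^(-4) the positive integral is a combination of the moments of orders 2, 3,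
  -- 4. Keeping the factors in `h3` and `h4` lets them hold for free when t is an endpoint, or when
  -- c = d = t.
  have := h.pos (h.hasDiffIntegral_quadratic hP hN 2)
    (ae_pow_pos hP (by decide)) (ae_pow_pos hN (by decide))
  simp only [Nat.reduceAdd, neg_mul, h2, h3, h4] at this
  simp at this

/-- With weight (t - x)^(-2) the moments of orders 1 and 2 drop out at a critical point, leaving the
moment of order 0, the difference of the masses. -/
lemma measureReal_univ_lt (h : SignPair P N c d) (ht : IsCritical P N c d t) :
    N.real univ < P.real univ := by
  have := h.pos (h.hasDiffIntegral_quadratic ht.offP ht.offN 0)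
    (ae_pow_pos ht.offP (by decide)) (ae_pow_pos ht.offN (by decide))
  simp only [zero_add, ht.mom_one, ht.mom_two] at this
  simpa [mom] using this

/-- The function `∫ (P - N)[dx] / (t - x)` has at most one critical point. -/
lemma critical_unique (h : SignPair P N c d) (ht : IsCritical P N c d t)
    (hs : IsCritical P N c d s) : s = t := by
  by_contra hst
  have := h.finP
  have := h.finN
  have hst' : s - t ≠ 0 := sub_ne_zero.2 hst
  -- Partial fractions of (x - c)(x - d) / ((t - x)^2 (s - x)^2). The double-pole coefficients
  -- contain (t - c)(t - d) and (s - c)(s - d), so the weak condition `mom_two` suffices to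
  -- annihilate every term. Only B and B' need explicit values.
  obtain ⟨A, A', B, B', hB, hB', key⟩ : ∃ A A' B B' : ℝ,
      B = (t - c) * (t - d) / (s - t) ^ 2 ∧ B' = (s - c) * (s - d) / (s - t) ^ 2 ∧
      ∀ x, t - x ≠ 0 → s - x ≠ 0 →
        A * ((t - x) ^ 1)⁻¹ + A' * ((s - x) ^ 1)⁻¹ + B * ((t - x) ^ 2)⁻¹ + B' * ((s - x) ^ 2)⁻¹
          = (x - c) * (x - d) * (((t - x) ^ 2)⁻¹ * ((s - x) ^ 2)⁻¹) := by
    refine ⟨(-(2 * t - c - d) * (s - t) - 2 * ((t - c) * (t - d))) / (s - t) ^ 3,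
      ((2 * s - c - d) * (t - s) + 2 * ((s - c) * (s - d))) / (s - t) ^ 3, _, _, rfl, rfl, ?_⟩
    intro x h1 h2
    field_simp
    ring
  have hd := ((((HasDiffIntegral.of_mom ht.offP ht.offN 1).const_mul A).add
    ((HasDiffIntegral.of_mom hs.offP hs.offN 1).const_mul A')).add
    ((HasDiffIntegral.of_mom ht.offP ht.offN 2).const_mul B)).add
    ((HasDiffIntegral.of_mom hs.offP hs.offN 2).const_mul B')
  have hd' := h.pos (g := fun x => ((t - x) ^ 2)⁻¹ * ((s - x) ^ 2)⁻¹) (hd.congr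
    (by
      filter_upwards [ae_ne_of_notMem_support ht.offP, ae_ne_of_notMem_support hs.offP]
        with x h1 h2 using key x h1 h2)
    (by
      filter_upwards [ae_ne_of_notMem_support ht.offN, ae_ne_of_notMem_support hs.offN]
        with x h1 h2 using key x h1 h2))
    (by
      filter_upwards [ae_pow_pos ht.offP (k := 2) (by decide),
        ae_pow_pos hs.offP (k := 2) (by decide)] with x h1 h2 using mul_pos h1 h2)
    (by
      filter_upwards [ae_pow_pos ht.offN (k := 2) (by decide),
        ae_pow_pos hs.offN (k := 2) (by decide)] with x h1 h2 using mul_pos h1 h2)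
  rw [ht.mom_one, hs.mom_one, hB, hB', div_mul_eq_mul_div, div_mul_eq_mul_div, ht.mom_two,
    hs.mom_two] at hd'
  simp at hd'

/-- If d < a, then P lives to the right of c and N to the left, so already x - c has the sign of P -
N; yet its integral against (t - x)^(-2) vanishes by `h1` and `h2`. -/
lemma le_left_of_linear (h : SignPair P N c d) (hP : t ∉ P.support) (hN : t ∉ N.support)
    (h1 : mom P N t 1 = 0) (h2 : (t - c) * mom P N t 2 = 0) {a : ℝ} (ha : ∀ᵐ x ∂P, a ≤ x) :
    a ≤ d := by
  by_contra hlt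
  rw [not_le] at hlt
  have hlin := (h.hasDiffIntegral_linear hP hN c).const_mul (-1)
  refine absurd (hlin.pos h.ne_zero ?_ ?_) (by rw [neg_mul (t - c), h1, h2]; simp)
  · filter_upwards [h.aeP, ha, ae_pow_pos hP (k := 2) (by decide)] with x hx hax hpos
    have : c < x := hx.resolve_left (by linarith)
    nlinarith
  · filter_upwards [h.aeN, ae_pow_pos hN (k := 2) (by decide)] with x hx hpos
    nlinarith

/-- Mirror image: if b < c, the factor d - x has the sign of P - N. -/
lemma right_le_of_linear (h : SignPair P N c d) (hP : t ∉ P.support) (hN : t ∉ N.support)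
    (h1 : mom P N t 1 = 0) (h2 : (t - d) * mom P N t 2 = 0) {b : ℝ} (hb : ∀ᵐ x ∂P, x ≤ b) :
    c ≤ b := by
  by_contra hlt
  rw [not_le] at hlt
  have hlin := h.hasDiffIntegral_linear hP hN d
  refine absurd (hlin.pos h.ne_zero ?_ ?_) (by rw [neg_mul (t - d), h1, h2]; simp)
  · filter_upwards [h.aeP, hb, ae_pow_pos hP (k := 2) (by decide)] with x hx hbx hpos
    have : x < d := hx.resolve_right (by linarith)
    nlinarith
  · filter_upwards [h.aeN, ae_pow_pos hN (k := 2) (by decide)] with x hx hpos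
    nlinarith

end SignPair

/-! ### The signed measure of f', the shape and the edge sets -/

/-- The positive part `μ|[χ,b] + μ|[a,χ+η-1]` of the measure defining `f'`. -/
noncomputable def posPart (μ : Measure ℝ) (p : ℝ × ℝ) : Measure ℝ :=
  μ.restrict (Ioo (p.1 + p.2 - 1) p.1)ᶜ

/-- The negative part `(λ-μ)|[χ+η-1,χ]` of the measure defining `f'`. -/
noncomputable def negPart (μ : Measure ℝ) (p : ℝ × ℝ) : Measure ℝ :=
  (co μ).restrict (Ioo (p.1 + p.2 - 1) p.1)

lemma support_restrict_union (ρ : Measure ℝ) (s u : Set ℝ) :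
    (ρ.restrict (s ∪ u)).support = (ρ.restrict s).support ∪ (ρ.restrict u).support := by
  refine subset_antisymm ?_ (union_subset ?_ ?_)
  · rw [← Measure.support_add]
    exact Measure.support_mono (Measure.restrict_union_le s u)
  · exact Measure.support_mono (Measure.restrict_mono_set _ subset_union_left)
  · exact Measure.support_mono (Measure.restrict_mono_set _ subset_union_right)

lemma nullSingletonClass_co (μ : Measure ℝ) : NullSingletonClass (co μ) :=
  ⟨fun y => le_antisymm ((Measure.sub_le (μ := volume) (ν := μ) _).trans (by simp)) zero_le⟩

lemma isFiniteMeasure_negPart (μ : Measure ℝ) (p : ℝ × ℝ) :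
    IsFiniteMeasure (negPart μ p) := by
  refine ⟨?_⟩
  rw [negPart, Measure.restrict_apply_univ]
  exact (Measure.sub_le (μ := volume) (ν := μ) _).trans_lt (by simp)

lemma restrict_negPart (μ : Measure ℝ) (p : ℝ × ℝ) :
    (co μ).restrict (Icc (p.1 + p.2 - 1) p.1) = negPart μ p := by
  have := nullSingletonClass_co μ
  exact (Measure.restrict_congr_set Ioo_ae_eq_Icc).symm

section

variable {μ : Measure ℝ} {a b : ℝ} {x : (n : ℕ) → Fin n → ℤ}
  {p : ℝ × ℝ} {t : ℝ}

namespace IsLimitMeasure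

lemma ae_mem_Icc (hμ : IsLimitMeasure μ a b x) : ∀ᵐ y ∂μ, y ∈ Icc a b := by
  filter_upwards [Measure.support_mem_ae (μ := μ)] with y hy using hμ.support_subset hy

variable [IsProbabilityMeasure μ]

lemma co_add (hμ : IsLimitMeasure μ a b x) : co μ + μ = volume :=
  Measure.sub_add_cancel_of_le hμ.le_volume

lemma nullSingletonClass (hμ : IsLimitMeasure μ a b x) : NullSingletonClass μ :=
  ⟨fun y => le_antisymm ((hμ.le_volume _).trans (by simp)) zero_le⟩

lemma signPair (hμ : IsLimitMeasure μ a b x) (hp : p.2 ≤ 1) :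
    SignPair (posPart μ p) (negPart μ p) p.1 (p.1 + p.2 - 1) := by
  have := hμ.nullSingletonClass
  have hne : ∀ r : ℝ, ∀ᵐ y ∂μ, y ≠ r := fun r => by
    rw [ae_iff]; simp
  refine ⟨by unfold posPart; infer_instance, isFiniteMeasure_negPart μ p, ?_, ?_, ?_, by linarith⟩
  · filter_upwards [ae_restrict_mem measurableSet_Ioo.compl, ae_restrict_of_ae (hne p.1),
      ae_restrict_of_ae (hne (p.1 + p.2 - 1))] with y h1 h2 h3
    by_contra! hcon
    exact h1 ⟨lt_of_le_of_ne hcon.1 h3.symm, lt_of_le_of_ne hcon.2 h2⟩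
  · filter_upwards [ae_restrict_mem measurableSet_Ioo] with y h1 using h1
  -- If P = 0, then μ lives in [d, c], which must contain a and b, so c - d > 1. If also N = 0,
  -- Lebesgue measure equals μ on (d, c), so c - d ≤ 1.
  · by_contra! hcon
    obtain ⟨h1, h2⟩ := hcon
    rw [posPart, Measure.restrict_eq_zero] at h1
    rw [negPart, Measure.restrict_eq_zero] at h2
    have hsub : μ.support ⊆ Icc (p.1 + p.2 - 1) p.1 := by
      refine Measure.support_subset_of_isClosed isClosed_Icc ?_
      filter_upwards [measure_eq_zero_iff_ae_notMem.1 h1] with y hy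
      exact Ioo_subset_Icc_self (not_not.1 hy)
    have ha := (hsub hμ.left_mem).1
    have hb := (hsub hμ.right_mem).2
    have hv : volume (Ioo (p.1 + p.2 - 1) p.1) ≤ 1 := by
      rw [← hμ.co_add, Measure.add_apply, h2, zero_add]
      exact prob_le_one
    rw [Real.volume_Ioo, ENNReal.ofReal_le_one] at hv
    linarith [hμ.one_lt]

/-- μ lives on [a, b] and has no atoms, so neither the outer bounds nor the endpoints c and d
matter. -/
lemma restrict_posPart (hμ : IsLimitMeasure μ a b x) (p : ℝ × ℝ) :
    μ.restrict (Icc p.1 b ∪ Icc a (p.1 + p.2 - 1)) = posPart μ p := by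
  have := hμ.nullSingletonClass
  refine Measure.restrict_congr_set ?_
  filter_upwards [hμ.ae_mem_Icc] with y hy
  have : y ∈ Icc p.1 b ∪ Icc a (p.1 + p.2 - 1) ↔ y ∈ (Ioo (p.1 + p.2 - 1) p.1)ᶜ := by
    simp only [mem_union, mem_Icc, hy.1, hy.2, mem_compl_iff, mem_Ioo]
    rw [not_and_or, not_lt, not_lt]
    tauto
  exact propext this

lemma singSet_eq (hμ : IsLimitMeasure μ a b x) (p : ℝ × ℝ) :
    singSet μ a b p = (posPart μ p).support ∪ (negPart μ p).support := by
  rw [singSet, ← hμ.restrict_posPart, ← restrict_negPart, support_restrict_union]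
  simp only [union_assoc, union_comm]

lemma fDer_eq (hμ : IsLimitMeasure μ a b x) (hp : p.2 ≤ 1) {w : ℂ}
    (hw : w ∉ Complex.ofReal '' (posPart μ p).support) :
    fDer μ a b p w = ∫ y : ℝ, ((w - (y : ℂ)) ^ 1)⁻¹ ∂(posPart μ p)
      - ∫ y : ℝ, ((w - (y : ℂ)) ^ 1)⁻¹ ∂(negPart μ p) := by
  have := hμ.nullSingletonClass
  have hfin := (hμ.signPair hp).finP
  have hint := integrable_inv_sub_pow hw 1
  -- For η = 1 the two closed intervals may share the point χ, which is μ-null.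
  have hdisj : AEDisjoint μ (Icc p.1 b) (Icc a (p.1 + p.2 - 1)) := by
    refine measure_mono_null (t := {p.1}) ?_ (measure_singleton _)
    rintro y ⟨h1, h2⟩
    exact le_antisymm (by linarith [h2.2]) h1.1
  rw [← hμ.restrict_posPart] at hint ⊢
  rw [← restrict_negPart, setIntegral_union₀ hdisj measurableSet_Icc.nullMeasurableSet
    (hint.mono_measure (Measure.restrict_mono_set _ subset_union_left))
    (hint.mono_measure (Measure.restrict_mono_set _ subset_union_right))]
  simp only [fDer, cauchyOn, pow_one, one_div]
  ring

lemma le_analyticOrderAt_fDer_iff (hμ : IsLimitMeasure μ a b x) (hp : p.2 ≤ 1)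
    (hP : t ∉ (posPart μ p).support) (hN : t ∉ (negPart μ p).support) (n : ℕ) :
    (n : ℕ∞) ≤ analyticOrderAt (fDer μ a b p) t ↔
      ∀ k < n, mom (posPart μ p) (negPart μ p) t (k + 1) = 0 := by
  have := (hμ.signPair hp).finP
  have := (hμ.signPair hp).finN
  rw [← le_analyticOrderAt_integral_inv_sub_iff hP hN, analyticOrderAt_congr]
  filter_upwards [eventually_notMem_image_support (ofReal_notMem_image hP)] with w hw
    using hμ.fDer_eq hp hw

lemma fDer_ofReal (hμ : IsLimitMeasure μ a b x) (hp : p.2 ≤ 1)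
    (hP : t ∉ (posPart μ p).support) :
    fDer μ a b p t = (mom (posPart μ p) (negPart μ p) t 1 : ℂ) := by
  rw [hμ.fDer_eq hp (ofReal_notMem_image hP), integral_complex_sub_eq_mom]

lemma isRootAt_iff (hμ : IsLimitMeasure μ a b x) (hp : p.2 ≤ 1) :
    IsRootAt μ a b p t ↔ t ∉ (posPart μ p).support ∧ t ∉ (negPart μ p).support ∧
      mom (posPart μ p) (negPart μ p) t 1 = 0 := by
  rw [IsRootAt, hμ.singSet_eq, mem_union, not_or, and_assoc]
  refine and_congr_right fun hP => and_congr_right fun _ => ?_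
  rw [hμ.fDer_ofReal hp hP, Complex.ofReal_eq_zero]

lemma isRepeatedRootAt_iff (hμ : IsLimitMeasure μ a b x) (hp : p.2 ≤ 1) :
    IsRepeatedRootAt μ a b p t ↔ t ∉ (posPart μ p).support ∧ t ∉ (negPart μ p).support ∧
      mom (posPart μ p) (negPart μ p) t 1 = 0 ∧ mom (posPart μ p) (negPart μ p) t 2 = 0 := by
  rw [IsRepeatedRootAt, hμ.singSet_eq, mem_union, not_or, and_assoc]
  refine and_congr_right fun hP => and_congr_right fun hN => ?_
  have := hμ.le_analyticOrderAt_fDer_iff hp hP hN 2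
  rw [Nat.cast_ofNat] at this
  rw [this]
  constructor
  · exact fun h => ⟨h 0 (by norm_num), h 1 (by norm_num)⟩
  · rintro ⟨h1, h2⟩ k hk
    interval_cases k
    exacts [h1, h2]

/-- Each of a ≤ d and c ≤ b comes either from a linear factor or, when that endpoint is t itself,
from t lying in the support. The second alternative serves R_1 and R_2, where the second moment need
not vanish. -/
lemma shape_of_isCritical (hμ : IsLimitMeasure μ a b x) (hp : p.2 ≤ 1)
    (h : IsCritical (posPart μ p) (negPart μ p) p.1 (p.1 + p.2 - 1) t)
    (ha : t ∈ μ.support ∧ t = p.1 + p.2 - 1 ∨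
      (t - p.1) * mom (posPart μ p) (negPart μ p) t 2 = 0)
    (hb : t ∈ μ.support ∧ t = p.1 ∨
      (t - (p.1 + p.2 - 1)) * mom (posPart μ p) (negPart μ p) t 2 = 0) :
    p ∈ Shape a b := by
  have hs := hμ.signPair hp
  have haeP : ∀ᵐ y ∂(posPart μ p), y ∈ Icc a b := ae_restrict_of_ae hμ.ae_mem_Icc
  have ha' : a ≤ p.1 + p.2 - 1 := by
    rcases ha with ha | ha
    · exact ha.2 ▸ (hμ.support_subset ha.1).1
    · exact hs.le_left_of_linear h.offP h.offN h.mom_one ha (haeP.mono fun y hy => hy.1)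
  have hb' : p.1 ≤ b := by
    rcases hb with hb | hb
    · exact hb.2 ▸ (hμ.support_subset hb.1).2
    · exact hs.right_le_of_linear h.offP h.offN h.mom_one hb (haeP.mono fun y hy => hy.2)
  -- On (d, c) the masses of λ - μ and μ add up to 1 - η, so the strict mass inequality reads 1 - η
  -- < 1.
  have hmass : 0 ≤ p.2 := by
    have hlt := hs.measureReal_univ_lt h
    have hfin := hs.finN
    rw [posPart, negPart, measureReal_restrict_apply_univ, measureReal_restrict_apply_univ,
      probReal_compl_eq_one_sub measurableSet_Ioo] at hlt
    have hsum : (co μ).real (Ioo (p.1 + p.2 - 1) p.1) + μ.real (Ioo (p.1 + p.2 - 1) p.1)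
        = 1 - p.2 := by
      rw [← measureReal_add_apply (h₁ := by
        have := measure_ne_top (negPart μ p) univ
        rwa [negPart, Measure.restrict_apply_univ] at this), hμ.co_add, Real.volume_real_Ioo_of_le
        (by linarith)]
      ring
    linarith
  exact ⟨⟨by linarith, hb'⟩, ⟨hmass, hp⟩, hb', by linarith, ha'⟩

lemma isRootOfMult_or (hμ : IsLimitMeasure μ a b x) (hp : p.2 ≤ 1)
    (h : IsCritical (posPart μ p) (negPart μ p) p.1 (p.1 + p.2 - 1) t) {n m : ℕ}
    (hn : ∀ k < n, mom (posPart μ p) (negPart μ p) t (k + 1) = 0)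
    (hm : ¬ ∀ k < m, mom (posPart μ p) (negPart μ p) t (k + 1) = 0) :
    ∃ j, n ≤ j ∧ j < m ∧ IsRootOfMult μ a b p t j := by
  rw [← hμ.le_analyticOrderAt_fDer_iff hp h.offP h.offN] at hn hm
  have hsing : t ∉ singSet μ a b p := by
    rw [hμ.singSet_eq]
    exact fun ht => ht.elim h.offP h.offN
  rw [not_le] at hm
  lift analyticOrderAt (fDer μ a b p) t to ℕ using hm.ne_top with j hj
  exact ⟨j, by exact_mod_cast hn, by exact_mod_cast hm, hsing, hj.symm⟩

/-- Which of the edge sets contains `(χ, η)` is decided by the position of the critical point. -/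
lemma mem_edge_sets_iff (hμ : IsLimitMeasure μ a b x) (hshape : p ∈ Shape a b)
    (h : IsCritical (posPart μ p) (negPart μ p) p.1 (p.1 + p.2 - 1) t) :
    (p ∈ Emu μ a b ↔ t ∉ Icc (p.1 + p.2 - 1) p.1) ∧
    (p ∈ Eco μ a b ↔ t ∈ Ioo (p.1 + p.2 - 1) p.1) ∧
    (p ∈ E0 μ a b ↔ p.2 = 1 ∧ t = p.1) ∧
    (p ∈ E1 μ a b ↔ p.2 < 1 ∧ t = p.1) ∧
    (p ∈ E2 μ a b ↔ p.2 < 1 ∧ t = p.1 + p.2 - 1) := by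
  have hp : p.2 ≤ 1 := hshape.2.1.2
  have hs := hμ.signPair hp
  -- Repeated roots, and below roots at c or d, are critical points, so uniqueness identifies each
  -- of them with t.
  have hrep : ∀ s, IsRepeatedRootAt μ a b p s → s = t := fun s hrs => by
    obtain ⟨h1, h2, h3, h4⟩ := (hμ.isRepeatedRootAt_iff hp).1 hrs
    exact hs.critical_unique h ⟨h1, h2, h3, by rw [h4, mul_zero]⟩
  have hroot : ∀ s, (s - p.1) * (s - (p.1 + p.2 - 1)) = 0 → IsRootAt μ a b p s → s = t :=
    fun s h0 hrs => by
      obtain ⟨h1, h2, h3⟩ := (hμ.isRootAt_iff hp).1 hrs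
      exact hs.critical_unique h ⟨h1, h2, h3, by rw [h0, zero_mul]⟩
  have hrt : IsRootAt μ a b p t := (hμ.isRootAt_iff hp).2 ⟨h.offP, h.offN, h.mom_one⟩
  have hrept : t ≠ p.1 → t ≠ p.1 + p.2 - 1 → IsRepeatedRootAt μ a b p t := fun h1 h2 =>
    (hμ.isRepeatedRootAt_iff hp).2 ⟨h.offP, h.offN, h.mom_one,
      (mul_eq_zero.1 h.mom_two).resolve_left (mul_ne_zero (sub_ne_zero.2 h1) (sub_ne_zero.2 h2))⟩
  refine ⟨⟨?_, fun ht => ⟨hshape, t, ht, hrept ?_ ?_⟩⟩, ⟨?_, fun ht => ⟨hshape, t, ht,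
    hrept ht.2.ne ht.1.ne'⟩⟩, ⟨?_, ?_⟩, ⟨?_, ?_⟩, ⟨?_, ?_⟩⟩
  · rintro ⟨_, s, hs1, hs2⟩
    exact hrep s hs2 ▸ hs1
  · rintro rfl
    exact ht ⟨by linarith, le_rfl⟩
  · rintro rfl
    exact ht ⟨le_rfl, by linarith⟩
  · rintro ⟨_, s, hs1, hs2⟩
    exact hrep s hs2 ▸ hs1
  · rintro ⟨_, h1, h2⟩
    exact ⟨h1, (hroot _ (by ring) h2).symm⟩
  · rintro ⟨h1, h2⟩
    exact ⟨hshape, h1, h2 ▸ hrt⟩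
  · rintro ⟨_, h1, h2⟩
    exact ⟨h1, (hroot _ (by ring) h2).symm⟩
  · rintro ⟨h1, h2⟩
    exact ⟨hshape, h1, h2 ▸ hrt⟩
  · rintro ⟨_, h1, h2⟩
    exact ⟨h1, (hroot _ (by ring) h2).symm⟩
  · rintro ⟨h1, h2⟩
    exact ⟨hshape, h1, h2 ▸ hrt⟩

end IsLimitMeasure

end

/-! ### Lebesgue integrals of inverse powers outside a window -/

section Truncated

variable {t δ : ℝ}

lemma le_abs_sub_of_notMem {y : ℝ} (hy : y ∉ Ioo (t - δ) (t + δ)) : δ ≤ |t - y| := by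
  by_contra hlt
  rw [not_le, abs_lt] at hlt
  exact hy ⟨by linarith, by linarith⟩

lemma integrableOn_inv_sub_pow (hδ : 0 < δ) {ρ : Measure ℝ} {s : Set ℝ} (hs : MeasurableSet s)
    (hρ : ρ s ≠ ⊤) (hsub : s ⊆ (Ioo (t - δ) (t + δ))ᶜ) (k : ℕ) :
    IntegrableOn (fun y => ((t - y) ^ k)⁻¹) s ρ := by
  refine Measure.integrableOn_of_bounded (M := (δ ^ k)⁻¹) hρ
    (by fun_prop : Measurable fun y : ℝ => ((t - y) ^ k)⁻¹).aestronglyMeasurable ?_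
  filter_upwards [ae_restrict_mem hs] with y hy
  rw [norm_inv, norm_pow, Real.norm_eq_abs]
  have := le_abs_sub_of_notMem (hsub hy)
  gcongr

/-- Integration of `1 / (t - y) ^ k` outside `(t - δ, t + δ)` through a primitive that is constant
on this interval. -/
lemma setIntegral_truncated_eq {k : ℕ} (hδ : 0 < δ) {f : ℝ → ℝ} (hf : Continuous f)
    (hl : ∀ y < t - δ, HasDerivAt f ((t - y) ^ k)⁻¹ y)
    (hm : ∀ y ∈ Ioo (t - δ) (t + δ), HasDerivAt f 0 y)
    (hr : ∀ y > t + δ, HasDerivAt f ((t - y) ^ k)⁻¹ y) {u v : ℝ} (huv : u ≤ v) :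
    ∫ y in (Ioo (t - δ) (t + δ))ᶜ ∩ Ioo u v, ((t - y) ^ k)⁻¹ = f v - f u := by
  have hJ : MeasurableSet (Ioo (t - δ) (t + δ))ᶜ := measurableSet_Ioo.compl
  have hint : IntegrableOn (fun y => ((t - y) ^ k)⁻¹) ((Ioo (t - δ) (t + δ))ᶜ ∩ Ioc u v) volume :=
    integrableOn_inv_sub_pow hδ (hJ.inter measurableSet_Ioc)
      ((measure_mono inter_subset_right).trans_lt measure_Ioc_lt_top).ne inter_subset_left k
  -- The primitive may fail to be differentiable at t ± δ; the fundamental theorem tolerates a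
  -- countable exceptional set.
  rw [← integral_eq_of_hasDerivAt_off_countable_of_le f
    ((Ioo (t - δ) (t + δ))ᶜ.indicator fun y => ((t - y) ^ k)⁻¹) huv (s := {t - δ, t + δ})
    (Set.to_countable _) hf.continuousOn, intervalIntegral.integral_of_le huv,
    integral_Ioc_eq_integral_Ioo, setIntegral_indicator hJ, inter_comm]
  · rintro y ⟨-, hy⟩
    simp only [mem_insert_iff, mem_singleton_iff, not_or] at hy
    rcases lt_or_gt_of_ne hy.1 with h1 | h1
    · rw [indicator_of_mem (by simp only [mem_compl_iff, mem_Ioo, not_and_or]; left; linarith)]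
      exact hl y h1
    rcases lt_or_gt_of_ne hy.2 with h2 | h2
    · rw [indicator_of_notMem (by simp only [mem_compl_iff, not_not]; exact ⟨h1, h2⟩)]
      exact hm y ⟨h1, h2⟩
    · rw [indicator_of_mem (by simp only [mem_compl_iff, mem_Ioo, not_and_or]; right; linarith)]
      exact hr y h2
  · rw [intervalIntegrable_iff_integrableOn_Ioc_of_le huv, IntegrableOn,
      integrable_indicator_iff hJ, IntegrableOn, Measure.restrict_restrict hJ]
    exact hint

/-- Minus a primitive of `1 / (t - y)`, made constant on `(t - δ, t + δ)`. -/
noncomputable def truncLog (t δ y : ℝ) : ℝ :=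
  Real.log (max δ (t - y)) + Real.log (max δ (y - t)) - Real.log δ

/-- A primitive of `1 / (t - y) ^ 2`, made constant on `(t - δ, t + δ)`. -/
noncomputable def truncInv (t δ y : ℝ) : ℝ := (max δ (t - y))⁻¹ - (max δ (y - t))⁻¹

lemma truncLog_of_le (hδ : 0 < δ) {y : ℝ} (hy : y ≤ t - δ) :
    truncLog t δ y = Real.log (t - y) := by
  rw [truncLog, max_eq_right (by linarith), max_eq_left (by linarith)]; ring

lemma truncLog_of_ge (hδ : 0 < δ) {y : ℝ} (hy : t + δ ≤ y) :
    truncLog t δ y = Real.log (y - t) := by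
  rw [truncLog, max_eq_left (by linarith), max_eq_right (by linarith)]; ring

lemma truncLog_of_mem {y : ℝ} (hy : y ∈ Icc (t - δ) (t + δ)) :
    truncLog t δ y = Real.log δ := by
  rw [truncLog, max_eq_left (by linarith [hy.1]), max_eq_left (by linarith [hy.2])]; ring

lemma truncInv_of_le (hδ : 0 < δ) {y : ℝ} (hy : y ≤ t - δ) :
    truncInv t δ y = (t - y)⁻¹ - δ⁻¹ := by
  rw [truncInv, max_eq_right (by linarith), max_eq_left (by linarith)]

lemma truncInv_of_ge (hδ : 0 < δ) {y : ℝ} (hy : t + δ ≤ y) :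
    truncInv t δ y = δ⁻¹ - (y - t)⁻¹ := by
  rw [truncInv, max_eq_left (by linarith), max_eq_right (by linarith)]

lemma truncInv_of_mem {y : ℝ} (hy : y ∈ Icc (t - δ) (t + δ)) : truncInv t δ y = 0 := by
  rw [truncInv, max_eq_left (by linarith [hy.1]), max_eq_left (by linarith [hy.2])]; ring

lemma setIntegral_truncated_one (hδ : 0 < δ) {u v : ℝ} (huv : u ≤ v) :
    ∫ y in (Ioo (t - δ) (t + δ))ᶜ ∩ Ioo u v, ((t - y) ^ 1)⁻¹
      = truncLog t δ u - truncLog t δ v := by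
  have hpos : ∀ r : ℝ, max δ r ≠ 0 := fun r => (lt_max_of_lt_left hδ).ne'
  rw [setIntegral_truncated_eq hδ (f := fun y => -truncLog t δ y) (k := 1) ?_ ?_ ?_ ?_ huv]
  · ring
  · unfold truncLog
    have h1 : Continuous fun y => Real.log (max δ (t - y)) :=
      (by fun_prop : Continuous fun y => max δ (t - y)).log fun y => hpos _
    have h2 : Continuous fun y => Real.log (max δ (y - t)) :=
      (by fun_prop : Continuous fun y => max δ (y - t)).log fun y => hpos _
    fun_prop
  · intro y hy
    have h : HasDerivAt (fun y => -Real.log (t - y)) ((t - y) ^ 1)⁻¹ y := by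
      refine (((hasDerivAt_id' y).const_sub t).log (by linarith)).neg.congr_deriv ?_
      rw [pow_one, neg_div, neg_neg, one_div]
    refine h.congr_of_eventuallyEq ?_
    filter_upwards [Iio_mem_nhds hy] with z hz
    rw [truncLog_of_le hδ hz.le]
  · intro y hy
    refine (hasDerivAt_const y (-Real.log δ)).congr_of_eventuallyEq ?_
    filter_upwards [Ioo_mem_nhds hy.1 hy.2] with z hz
    rw [truncLog_of_mem (Ioo_subset_Icc_self hz)]
  · intro y hy
    have h : HasDerivAt (fun y => -Real.log (y - t)) ((t - y) ^ 1)⁻¹ y := by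
      refine (((hasDerivAt_id' y).sub_const t).log (by linarith)).neg.congr_deriv ?_
      rw [pow_one, one_div, ← inv_neg, neg_sub]
    refine h.congr_of_eventuallyEq ?_
    filter_upwards [Ioi_mem_nhds hy] with z hz
    rw [truncLog_of_ge hδ hz.le]

lemma setIntegral_truncated_two (hδ : 0 < δ) {u v : ℝ} (huv : u ≤ v) :
    ∫ y in (Ioo (t - δ) (t + δ))ᶜ ∩ Ioo u v, ((t - y) ^ 2)⁻¹
      = truncInv t δ v - truncInv t δ u := by
  have hpos : ∀ r : ℝ, max δ r ≠ 0 := fun r => (lt_max_of_lt_left hδ).ne'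
  refine setIntegral_truncated_eq hδ (f := truncInv t δ) (k := 2) ?_ ?_ ?_ ?_ huv
  · unfold truncInv
    have h1 : Continuous fun y => (max δ (t - y))⁻¹ :=
      (by fun_prop : Continuous fun y => max δ (t - y)).inv₀ fun y => hpos _
    have h2 : Continuous fun y => (max δ (y - t))⁻¹ :=
      (by fun_prop : Continuous fun y => max δ (y - t)).inv₀ fun y => hpos _
    fun_prop
  · intro y hy
    have h : HasDerivAt (fun y => (t - y)⁻¹ - δ⁻¹) ((t - y) ^ 2)⁻¹ y := by
      refine ((((hasDerivAt_id' y).const_sub t).fun_inv (by linarith)).sub_const _).congr_deriv ?_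
      rw [neg_neg, one_div]
    refine h.congr_of_eventuallyEq ?_
    filter_upwards [Iio_mem_nhds hy] with z hz
    rw [truncInv_of_le hδ hz.le]
  · intro y hy
    refine (hasDerivAt_const y 0).congr_of_eventuallyEq ?_
    filter_upwards [Ioo_mem_nhds hy.1 hy.2] with z hz
    rw [truncInv_of_mem (Ioo_subset_Icc_self hz)]
  · intro y hy
    have h : HasDerivAt (fun y => δ⁻¹ - (y - t)⁻¹) ((t - y) ^ 2)⁻¹ y := by
      refine ((((hasDerivAt_id' y).sub_const t).fun_inv (by linarith)).const_sub _).congr_deriv ?_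
      rw [neg_div, neg_neg, one_div, ← neg_sub, neg_sq]
    refine h.congr_of_eventuallyEq ?_
    filter_upwards [Ioi_mem_nhds hy] with z hz
    rw [truncInv_of_ge hδ hz.le]

end Truncated

/-! ### Explicit moments from the local model at t -/

section

variable {μ : Measure ℝ} {a b : ℝ} {x : (n : ℕ) → Fin n → ℤ}
  {p : ℝ × ℝ} {t δ t₁ t₂ u v : ℝ}

/-- Near `t` the measure `μ` is Lebesgue measure on `(u, v)`, and `(u, v)` agrees with
`(χ + η - 1, χ)` on `(t - δ, t + δ)`. -/
structure LocalModel (μ : Measure ℝ) (p : ℝ × ℝ) (t δ t₂ t₁ u v : ℝ) : Prop where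
  pos : 0 < δ
  left : t₂ ≤ t - δ
  right : t + δ ≤ t₁
  restrict_eq : μ.restrict (Ioo t₂ t₁) = volume.restrict (Ioo u v)
  agree : ∀ y ∈ Ioo (t - δ) (t + δ), y ∈ Ioo u v ↔ y ∈ Ioo (p.1 + p.2 - 1) p.1

namespace LocalModel

lemma subset (h : LocalModel μ p t δ t₂ t₁ u v) : Ioo (t - δ) (t + δ) ⊆ Ioo t₂ t₁ :=
  Ioo_subset_Ioo h.left h.right

lemma mem_nhds (h : LocalModel μ p t δ t₂ t₁ u v) : Ioo (t - δ) (t + δ) ∈ 𝓝 t :=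
  Ioo_mem_nhds (by linarith [h.pos]) (by linarith [h.pos])

lemma measure_inter (h : LocalModel μ p t δ t₂ t₁ u v) {s : Set ℝ} (hs : MeasurableSet s)
    (hsub : s ⊆ Ioo t₂ t₁) : μ s = volume (s ∩ Ioo u v) := by
  rw [← Measure.restrict_apply hs, ← h.restrict_eq, Measure.restrict_apply hs,
    inter_eq_left.2 hsub]

/-- In the window μ charges only (u, v), which there coincides with the interval (d, c) removed from
P. -/
lemma posPart_eq_zero (h : LocalModel μ p t δ t₂ t₁ u v) :
    posPart μ p (Ioo (t - δ) (t + δ)) = 0 := by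
  rw [posPart, Measure.restrict_apply measurableSet_Ioo, h.measure_inter
    (measurableSet_Ioo.inter measurableSet_Ioo.compl) (inter_subset_left.trans h.subset)]
  refine measure_mono_null (t := ∅) ?_ measure_empty
  rintro y ⟨⟨h1, h2⟩, h3⟩
  exact h2 ((h.agree y h1).1 h3)

lemma notMem_posPart (h : LocalModel μ p t δ t₂ t₁ u v) : t ∉ (posPart μ p).support :=
  Measure.notMem_support_iff_exists.2 ⟨_, h.mem_nhds, h.posPart_eq_zero⟩

variable [IsProbabilityMeasure μ]

/-- Inside the window μ is Lebesgue measure on (d, c), so λ - μ has no mass there; finiteness of μ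
permits the cancellation. -/
lemma negPart_eq_zero (hμ : IsLimitMeasure μ a b x) (h : LocalModel μ p t δ t₂ t₁ u v) :
    negPart μ p (Ioo (t - δ) (t + δ)) = 0 := by
  rw [negPart, Measure.restrict_apply measurableSet_Ioo]
  set s := Ioo (t - δ) (t + δ) ∩ Ioo (p.1 + p.2 - 1) p.1 with hs
  have h1 : μ s = volume s := by
    rw [h.measure_inter (measurableSet_Ioo.inter measurableSet_Ioo)
      (inter_subset_left.trans h.subset), inter_eq_left.2]
    rintro y ⟨h1, h2⟩
    exact (h.agree y h1).2 h2
  have h2 : co μ s + μ s = 0 + μ s := by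
    rw [← Measure.add_apply, hμ.co_add, h1, zero_add]
  exact (ENNReal.add_left_inj (measure_ne_top μ s)).1 h2

lemma notMem_negPart (hμ : IsLimitMeasure μ a b x) (h : LocalModel μ p t δ t₂ t₁ u v) :
    t ∉ (negPart μ p).support :=
  Measure.notMem_support_iff_exists.2 ⟨_, h.mem_nhds, h.negPart_eq_zero hμ⟩

lemma setIntegral_compl (h : LocalModel μ p t δ t₂ t₁ u v) (k : ℕ) :
    ∫ y in (Ioo (t - δ) (t + δ))ᶜ, ((t - y) ^ k)⁻¹ ∂μ
      = ∫ y in (Ioo t₂ t₁)ᶜ, ((t - y) ^ k)⁻¹ ∂μ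
        + ∫ y in (Ioo (t - δ) (t + δ))ᶜ ∩ Ioo u v, ((t - y) ^ k)⁻¹ := by
  have hJ : MeasurableSet (Ioo (t - δ) (t + δ))ᶜ := measurableSet_Ioo.compl
  rw [← Measure.restrict_restrict hJ, ← h.restrict_eq, Measure.restrict_restrict hJ,
    ← integral_inter_add_sdiff (s := (Ioo (t - δ) (t + δ))ᶜ) (measurableSet_Ioo (a := t₂) (b := t₁))
      (integrableOn_inv_sub_pow h.pos hJ (measure_ne_top _ _) subset_rfl k), add_comm]
  congr 3
  rw [sdiff_eq, inter_eq_right]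
  exact compl_subset_compl.2 h.subset

/-- Off the window P - N is μ minus Lebesgue measure on (d, c), because -(λ - μ) = μ - λ there. The
part of μ inside (t₂, t₁) is again Lebesgue measure, on (u, v). -/
lemma mom_eq (hμ : IsLimitMeasure μ a b x) (h : LocalModel μ p t δ t₂ t₁ u v) (k : ℕ) :
    mom (posPart μ p) (negPart μ p) t k = ∫ y in (Ioo t₂ t₁)ᶜ, ((t - y) ^ k)⁻¹ ∂μ
      + (∫ y in (Ioo (t - δ) (t + δ))ᶜ ∩ Ioo u v, ((t - y) ^ k)⁻¹)
      - ∫ y in (Ioo (t - δ) (t + δ))ᶜ ∩ Ioo (p.1 + p.2 - 1) p.1, ((t - y) ^ k)⁻¹ := by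
  have hJ : MeasurableSet (Ioo (t - δ) (t + δ))ᶜ := measurableSet_Ioo.compl
  set J := (Ioo (t - δ) (t + δ))ᶜ with hJdef
  set D := Ioo (p.1 + p.2 - 1) p.1 with hD
  have hDm : MeasurableSet D := measurableSet_Ioo
  have hP : posPart μ p = μ.restrict (J \ D) := by
    have := Measure.restrict_eq_self_of_ae_mem (μ := posPart μ p) (s := J)
      (measure_eq_zero_iff_ae_notMem.1 h.posPart_eq_zero)
    rw [← this, posPart, Measure.restrict_restrict hJ, sdiff_eq]
  have hN : negPart μ p = (co μ).restrict (J ∩ D) := by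
    have := Measure.restrict_eq_self_of_ae_mem (μ := negPart μ p) (s := J)
      (measure_eq_zero_iff_ae_notMem.1 (h.negPart_eq_zero hμ))
    rw [← this, negPart, Measure.restrict_restrict hJ]
  have hfin : volume (J ∩ D) ≠ ⊤ :=
    ((measure_mono inter_subset_right).trans_lt measure_Ioo_lt_top).ne
  have hvol : ∫ y in J ∩ D, ((t - y) ^ k)⁻¹ = ∫ y in J ∩ D, ((t - y) ^ k)⁻¹ ∂(co μ)
      + ∫ y in J ∩ D, ((t - y) ^ k)⁻¹ ∂μ := by
    rw [← hμ.co_add, Measure.restrict_add, integral_add_measure]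
    · refine integrableOn_inv_sub_pow h.pos (hJ.inter hDm) ?_ inter_subset_left k
      exact ((Measure.sub_le (μ := volume) (ν := μ) _).trans_lt hfin.lt_top).ne
    · exact integrableOn_inv_sub_pow h.pos (hJ.inter hDm) (measure_ne_top _ _) inter_subset_left k
  have hsplit := integral_inter_add_sdiff (s := J) hDm
    (integrableOn_inv_sub_pow h.pos hJ (measure_ne_top μ _) subset_rfl k)
  have hc := h.setIntegral_compl k
  rw [← hJdef] at hc
  rw [mom, hP, hN]
  linarith

lemma mom_one (hμ : IsLimitMeasure μ a b x) (hp : p.2 ≤ 1) (huv : u ≤ v)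
    (h : LocalModel μ p t δ t₂ t₁ u v) :
    mom (posPart μ p) (negPart μ p) t 1 = ∫ y in (Ioo t₂ t₁)ᶜ, ((t - y) ^ 1)⁻¹ ∂μ
      + (truncLog t δ u - truncLog t δ v)
      - (truncLog t δ (p.1 + p.2 - 1) - truncLog t δ p.1) := by
  rw [h.mom_eq hμ, setIntegral_truncated_one (t := t) h.pos huv,
    setIntegral_truncated_one (t := t) h.pos (by linarith)]

lemma mom_two (hμ : IsLimitMeasure μ a b x) (hp : p.2 ≤ 1) (huv : u ≤ v)
    (h : LocalModel μ p t δ t₂ t₁ u v) :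
    mom (posPart μ p) (negPart μ p) t 2 = ∫ y in (Ioo t₂ t₁)ᶜ, ((t - y) ^ 2)⁻¹ ∂μ
      + (truncInv t δ v - truncInv t δ u)
      - (truncInv t δ p.1 - truncInv t δ (p.1 + p.2 - 1)) := by
  rw [h.mom_eq hμ, setIntegral_truncated_two (t := t) h.pos huv,
    setIntegral_truncated_two (t := t) h.pos (by linarith)]

end LocalModel

end

/-! ### The edge curve produces critical points -/

lemma exists_pos_le_four {r₁ r₂ r₃ r₄ : ℝ} (h₁ : 0 < r₁) (h₂ : 0 < r₂) (h₃ : 0 < r₃)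
    (h₄ : 0 < r₄) : ∃ δ > 0, δ ≤ r₁ ∧ δ ≤ r₂ ∧ δ ≤ r₃ ∧ δ ≤ r₄ :=
  ⟨min (min r₁ r₂) (min r₃ r₄), lt_min (lt_min h₁ h₂) (lt_min h₃ h₄), by simp, by simp, by simp,
    by simp⟩

lemma measure_Ioo_eq_zero_of_subset {ρ : Measure ℝ} {u v : ℝ} (h : Ioo u v ⊆ ρ.supportᶜ) :
    ρ (Ioo u v) = 0 :=
  measure_mono_null h Measure.measure_compl_support

section

variable {μ : Measure ℝ} {a b : ℝ} {x : (n : ℕ) → Fin n → ℤ}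
  {I : ℝ → ℝ × ℝ} {p : ℝ × ℝ} {t t₁ t₂ : ℝ}

lemma realCauchyOn_eq_CI (a b : ℝ) {J : ℝ × ℝ} (hJ : μ (Ioo J.1 J.2) = 0) :
    realCauchyOn μ (Icc a b) = CI μ a b J := by
  funext s
  rw [CI, realCauchyOn, realCauchyOn, Measure.restrict_congr_set (sdiff_null_ae_eq_self hJ)]

lemma C_ofReal (μ : Measure ℝ) (a b t : ℝ) : C μ a b t = (realCauchyOn μ (Icc a b) t : ℂ) := by
  rw [C, cauchyOn, realCauchyOn, ← integral_complex_ofReal]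
  simp

/-- The empty interval (t, t) lets a gap of μ enter the local model with u = v = t. -/
lemma restrict_eq_of_gap (t : ℝ) (hJ : μ (Ioo t₂ t₁) = 0) :
    μ.restrict (Ioo t₂ t₁) = volume.restrict (Ioo t t) := by
  rw [Measure.restrict_eq_zero.2 hJ, Ioo_self, Measure.restrict_empty]

lemma mem_support_of_mem_frontier {ρ : Measure ℝ} (ht : t ∈ frontier (ρ.supportᶜ)) :
    t ∈ ρ.support := by
  rw [frontier_compl] at ht
  exact Measure.isClosed_support.frontier_subset ht

lemma edge_of_off (μ : Measure ℝ) (a b : ℝ) (I : ℝ → ℝ × ℝ)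
    (ht : t ∉ μ.support ∨ t ∉ (co μ).support) :
    (edge μ a b I t).1 = t + (expC μ a b I t - 1) / (expC μ a b I t * derC μ a b I t) ∧
    (edge μ a b I t).2 = 1 + (expC μ a b I t - 1) ^ 2 / (expC μ a b I t * derC μ a b I t) := by
  rw [edge, if_pos ht]
  exact ⟨rfl, rfl⟩

/-- The interval `(χ+η-1, χ)` in the rational parametrization of the edge curve. -/
lemma edge_ends {E D c η : ℝ} (hE : E ≠ 0) (hD : D ≠ 0) (hc : c = t + (E - 1) / (E * D))
    (hη : η = 1 + (E - 1) ^ 2 / (E * D)) :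
    c - t = (E - 1) / (E * D) ∧ c + η - 1 - t = E * (c - t) ∧ E * D * (c - t) = E - 1 := by
  subst hc hη
  refine ⟨by ring, ?_, ?_⟩ <;> (field_simp; try ring)

namespace IsLimitMeasure

lemma restrict_Icc_sdiff (hμ : IsLimitMeasure μ a b x) (s : Set ℝ) :
    μ.restrict (Icc a b \ s) = μ.restrict sᶜ := by
  refine Measure.restrict_congr_set ?_
  filter_upwards [hμ.ae_mem_Icc] with y hy
  exact propext (and_iff_right hy)

lemma CI_eq (hμ : IsLimitMeasure μ a b x) (J : ℝ × ℝ) (s : ℝ) :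
    CI μ a b J s = ∫ y in (Ioo J.1 J.2)ᶜ, ((s - y) ^ 1)⁻¹ ∂μ := by
  rw [CI, realCauchyOn, hμ.restrict_Icc_sdiff]
  simp

variable [IsProbabilityMeasure μ]

lemma deriv_CI (hμ : IsLimitMeasure μ a b x) {J : ℝ × ℝ} (ht : t ∈ Ioo J.1 J.2) :
    deriv (CI μ a b J) t = -∫ y in (Ioo J.1 J.2)ᶜ, ((t - y) ^ 2)⁻¹ ∂μ := by
  rw [← hμ.restrict_Icc_sdiff]
  refine (hasDerivAt_real_integral_inv_sub (ρ := μ.restrict (Icc a b \ Ioo J.1 J.2)) ?_).deriv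
  refine Measure.notMem_support_iff_exists.2 ⟨_, Ioo_mem_nhds ht.1 ht.2, ?_⟩
  rw [Measure.restrict_apply measurableSet_Ioo, inter_sdiff_self, measure_empty]

/-- This is -C'(t) in a gap; it is positive since all the mass of μ lies outside. -/
lemma integral_inv_sq_pos (_ : IsLimitMeasure μ a b x) (hJ : μ (Ioo t₂ t₁) = 0)
    (ht : t ∈ Ioo t₂ t₁) : 0 < ∫ y in (Ioo t₂ t₁)ᶜ, ((t - y) ^ 2)⁻¹ ∂μ := by
  have hsupp : t ∉ (μ.restrict (Ioo t₂ t₁)ᶜ).support := by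
    refine Measure.notMem_support_iff_exists.2 ⟨_, Ioo_mem_nhds ht.1 ht.2, ?_⟩
    exact le_antisymm ((Measure.restrict_apply_le _ _).trans hJ.le) zero_le
  refine integral_pos_of_ae_pos ?_ (integrable_real_inv_sub_pow hsupp 2)
    (SignPair.ae_pow_pos hsupp (by decide))
  rw [Ne, Measure.restrict_eq_zero, prob_compl_eq_zero_iff measurableSet_Ioo, hJ]
  exact zero_ne_one

lemma restrict_eq_of_full (hμ : IsLimitMeasure μ a b x) (hJ : co μ (Ioo t₂ t₁) = 0) :
    μ.restrict (Ioo t₂ t₁) = volume.restrict (Ioo t₂ t₁) := by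
  rw [← hμ.co_add, Measure.restrict_add, Measure.restrict_eq_zero.2 hJ, zero_add]

lemma ae_ne (hμ : IsLimitMeasure μ a b x) (t : ℝ) : ∀ᵐ y ∂μ, y ≠ t := by
  have := hμ.nullSingletonClass
  rw [ae_iff]
  simp

lemma restrict_eq_of_adm1 (hμ : IsLimitMeasure μ a b x) {J : ℝ × ℝ} (h : Adm1 μ t J) :
    μ.restrict (Ioo J.1 J.2) = volume.restrict (Ioo J.1 t) := by
  rw [← hμ.restrict_eq_of_full (measure_Ioo_eq_zero_of_subset h.2.2)]
  refine Measure.restrict_congr_set ?_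
  filter_upwards [hμ.ae_ne t,
    measure_eq_zero_iff_ae_notMem.1 (measure_Ioo_eq_zero_of_subset h.2.1)] with y h1 h2
  refine propext ⟨fun hy => ⟨hy.1, ?_⟩, fun hy => ⟨hy.1, hy.2.trans h.1.2⟩⟩
  by_contra hcon
  exact h2 ⟨lt_of_le_of_ne (not_lt.1 hcon) h1.symm, hy.2⟩

lemma restrict_eq_of_adm2 (hμ : IsLimitMeasure μ a b x) {J : ℝ × ℝ} (h : Adm2 μ t J) :
    μ.restrict (Ioo J.1 J.2) = volume.restrict (Ioo t J.2) := by
  rw [← hμ.restrict_eq_of_full (measure_Ioo_eq_zero_of_subset h.2.1)]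
  refine Measure.restrict_congr_set ?_
  filter_upwards [hμ.ae_ne t,
    measure_eq_zero_iff_ae_notMem.1 (measure_Ioo_eq_zero_of_subset h.2.2)] with y h1 h2
  refine propext ⟨fun hy => ⟨?_, hy.2⟩, fun hy => ⟨h.1.1.trans hy.1, hy.2⟩⟩
  by_contra hcon
  exact h2 ⟨hy.1, lt_of_le_of_ne (not_lt.1 hcon) h1⟩

/-- The supports of μ and λ - μ cover the line, since the two measures add up to Lebesgue measure.
-/
lemma mem_support_co (hμ : IsLimitMeasure μ a b x) (ht : t ∉ μ.support) :
    t ∈ (co μ).support := by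
  have h : t ∈ (co μ + μ).support := by
    rw [hμ.co_add, Measure.support_eq_univ]
    exact mem_univ t
  rw [Measure.support_add] at h
  exact h.resolve_right ht

/-- Gaps of μ on both sides of t merge into one gap, as t is not an atom. -/
lemma not_adm_both (hμ : IsLimitMeasure μ a b x) {J K : ℝ × ℝ} (h1 : Adm1 μ t J)
    (h2 : Adm2 μ t K) : t ∉ μ.support := by
  refine Measure.notMem_support_iff_exists.2 ⟨Ioo K.1 J.2, Ioo_mem_nhds h2.1.1 h1.1.2, ?_⟩
  rw [measure_eq_zero_iff_ae_notMem]
  filter_upwards [hμ.ae_ne t,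
    measure_eq_zero_iff_ae_notMem.1 (measure_Ioo_eq_zero_of_subset h1.2.1),
    measure_eq_zero_iff_ae_notMem.1 (measure_Ioo_eq_zero_of_subset h2.2.2)] with y hy hy1 hy2 hmem
  rcases lt_or_gt_of_ne hy with h | h
  · exact hy2 ⟨hmem.1, h⟩
  · exact hy1 ⟨h, hmem.2⟩

/-- Here E = e^C > 0 and D = C' < 0, so d - t = E (c - t) puts d and c on the same side of t. The
relation between the endpoints kills the first moment, and E D (c - t) = E - 1 kills the second. -/
lemma edge_gap (hμ : IsLimitMeasure μ a b x) (ht : t ∈ Rmu μ a b) (I : ℝ → ℝ × ℝ) :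
    (edge μ a b I t).2 ≤ 1 ∧
    t ∉ Icc ((edge μ a b I t).1 + (edge μ a b I t).2 - 1) (edge μ a b I t).1 ∧
    t ∉ (posPart μ (edge μ a b I t)).support ∧ t ∉ (negPart μ (edge μ a b I t)).support ∧
    mom (posPart μ (edge μ a b I t)) (negPart μ (edge μ a b I t)) t 1 = 0 ∧
    mom (posPart μ (edge μ a b I t)) (negPart μ (edge μ a b I t)) t 2 = 0 := by
  obtain ⟨htμ, hC⟩ := ht
  obtain ⟨⟨t₂, t₁⟩, htJ, hJ⟩ := (nhds_basis_Ioo t).notMem_measureSupport.1 htμ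
  rw [C_ofReal, Complex.ofReal_ne_zero, realCauchyOn_eq_CI a b hJ] at hC
  have hexp : expC μ a b I t = Real.exp (CI μ a b (t₂, t₁) t) := by
    rw [expC, if_pos htμ, realCauchyOn_eq_CI a b hJ]
  have hder : derC μ a b I t = -∫ y in (Ioo t₂ t₁)ᶜ, ((t - y) ^ 2)⁻¹ ∂μ := by
    rw [derC, if_pos htμ, realCauchyOn_eq_CI a b hJ, hμ.deriv_CI htJ]
  have hS := hμ.integral_inv_sq_pos hJ htJ
  obtain ⟨hc, hη⟩ := edge_of_off μ a b I (Or.inl htμ)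
  have hK := hμ.CI_eq (t₂, t₁) t
  set p := edge μ a b I t
  set K := CI μ a b (t₂, t₁) t
  set E := expC μ a b I t
  set D := derC μ a b I t
  have hE : 0 < E := hexp ▸ Real.exp_pos _
  have hD : D < 0 := by linarith
  have hlogE : Real.log E = K := by rw [hexp, Real.log_exp]
  have hE1 : E ≠ 1 := by
    intro h
    rw [h, Real.log_one] at hlogE
    exact hC hlogE.symm
  obtain ⟨hct, hdt, hrel⟩ := edge_ends hE.ne' hD.ne hc hη
  have hp : p.2 < 1 := by
    have : (E - 1) ^ 2 / (E * D) < 0 :=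
      div_neg_of_pos_of_neg (sq_pos_of_ne_zero (sub_ne_zero.2 hE1)) (mul_neg_of_pos_of_neg hE hD)
    linarith
  have hED : E * D < 0 := mul_neg_of_pos_of_neg hE hD
  refine ⟨hp.le, ?_⟩
  -- Since c - t = (E - 1)/(E D) with E D < 0, t lies left of [d, c] when E < 1 and right of it when
  -- E > 1.
  rcases lt_or_gt_of_ne hE1 with hlt | hgt
  · have h1 : 0 < p.1 - t := hct ▸ div_pos_of_neg_of_neg (by linarith) hED
    have h2 : 0 < p.1 + p.2 - 1 - t := hdt ▸ mul_pos hE h1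
    obtain ⟨δ, hδ, hδ1, hδ2, hδ3, hδ4⟩ := exists_pos_le_four (sub_pos.2 htJ.1) (sub_pos.2 htJ.2)
      h1 h2
    have hloc : LocalModel μ p t δ t₂ t₁ t t := by
      refine ⟨hδ, by linarith, by linarith, restrict_eq_of_gap t hJ, fun y hy => ?_⟩
      simp only [Ioo_self, mem_empty_iff_false, false_iff, mem_Ioo, not_and, not_lt]
      intro h
      linarith [hy.2]
    refine ⟨fun h => by linarith [h.1], hloc.notMem_posPart, hloc.notMem_negPart hμ, ?_, ?_⟩
    · rw [hloc.mom_one hμ hp.le le_rfl, truncLog_of_ge hδ (by linarith : t + δ ≤ p.1),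
        truncLog_of_ge hδ (by linarith : t + δ ≤ p.1 + p.2 - 1), hdt,
        Real.log_mul hE.ne' h1.ne', hlogE, hK]
      ring
    · rw [hloc.mom_two hμ hp.le le_rfl, truncInv_of_ge hδ (by linarith : t + δ ≤ p.1),
        truncInv_of_ge hδ (by linarith : t + δ ≤ p.1 + p.2 - 1), hdt,
        (by linarith : ∫ y in (Ioo t₂ t₁)ᶜ, ((t - y) ^ 2)⁻¹ ∂μ = -D)]
      have : D = (p.1 - t)⁻¹ - (E * (p.1 - t))⁻¹ := by
        field_simp
        linarith
      linarith
  · have h1 : 0 < t - p.1 := by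
      have : p.1 - t < 0 := hct ▸ div_neg_of_pos_of_neg (by linarith) hED
      linarith
    have hdt' : t - (p.1 + p.2 - 1) = E * (t - p.1) := by linarith
    have h2 : 0 < t - (p.1 + p.2 - 1) := hdt' ▸ mul_pos hE h1
    obtain ⟨δ, hδ, hδ1, hδ2, hδ3, hδ4⟩ := exists_pos_le_four (sub_pos.2 htJ.1) (sub_pos.2 htJ.2)
      h1 h2
    have hloc : LocalModel μ p t δ t₂ t₁ t t := by
      refine ⟨hδ, by linarith, by linarith, restrict_eq_of_gap t hJ, fun y hy => ?_⟩
      simp only [Ioo_self, mem_empty_iff_false, false_iff, mem_Ioo, not_and, not_lt]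
      intro h
      linarith [hy.1]
    refine ⟨fun h => by linarith [h.2], hloc.notMem_posPart, hloc.notMem_negPart hμ, ?_, ?_⟩
    · rw [hloc.mom_one hμ hp.le le_rfl, truncLog_of_le hδ (by linarith : p.1 ≤ t - δ),
        truncLog_of_le hδ (by linarith : p.1 + p.2 - 1 ≤ t - δ), hdt',
        Real.log_mul hE.ne' h1.ne', hlogE, hK]
      ring
    · rw [hloc.mom_two hμ hp.le le_rfl, truncInv_of_le hδ (by linarith : p.1 ≤ t - δ),
        truncInv_of_le hδ (by linarith : p.1 + p.2 - 1 ≤ t - δ), hdt',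
        (by linarith : ∫ y in (Ioo t₂ t₁)ᶜ, ((t - y) ^ 2)⁻¹ ∂μ = -D)]
      have : D = (E * (t - p.1))⁻¹ - (t - p.1)⁻¹ := by
        field_simp
        linarith
      linarith

/-- This says that the extension of C' is positive where μ is Lebesgue measure. As μ ≤ λ lives on a
bounded interval, its integral off the window is at most the Lebesgue integral over a bounded (A,
B), which is strictly below 2/δ, the value for the whole line. -/
lemma integral_inv_sq_lt (hμ : IsLimitMeasure μ a b x) (hJ : co μ (Ioo t₂ t₁) = 0)
    (ht : t ∈ Ioo t₂ t₁) :
    ∫ y in (Ioo t₂ t₁)ᶜ, ((t - y) ^ 2)⁻¹ ∂μ < (t - t₂)⁻¹ + (t₁ - t)⁻¹ := by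
  obtain ⟨δ, hδ, hδ1, hδ2, -, -⟩ := exists_pos_le_four (sub_pos.2 ht.1) (sub_pos.2 ht.2)
    one_pos one_pos
  set A := min (a - 1) (t - δ - 1)
  set B := max (b + 1) (t + δ + 1)
  have hA1 : A ≤ a - 1 := min_le_left _ _
  have hA2 : A ≤ t - δ - 1 := min_le_right _ _
  have hB1 : b + 1 ≤ B := le_max_left _ _
  have hB2 : t + δ + 1 ≤ B := le_max_right _ _
  -- An auxiliary point with d = A and c = B; only the splitting of the μ-integral is used, which
  -- does not involve it.
  have hloc : LocalModel μ (B, A - B + 1) t δ t₂ t₁ t₂ t₁ := by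
    refine ⟨hδ, by linarith, by linarith, hμ.restrict_eq_of_full hJ, fun y hy => ?_⟩
    exact iff_of_true ⟨by linarith [hy.1], by linarith [hy.2]⟩
      ⟨by simp only; linarith [hy.1], by simp only; linarith [hy.2]⟩
  have hc := hloc.setIntegral_compl 2
  rw [setIntegral_truncated_two (t := t) hδ (by linarith [ht.1, ht.2]),
    truncInv_of_le hδ (by linarith : t₂ ≤ t - δ),
    truncInv_of_ge hδ (by linarith : t + δ ≤ t₁)] at hc
  have hJm : MeasurableSet (Ioo (t - δ) (t + δ))ᶜ := measurableSet_Ioo.compl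
  have hae : μ.restrict (Ioo (t - δ) (t + δ))ᶜ
      = μ.restrict ((Ioo (t - δ) (t + δ))ᶜ ∩ Ioo A B) := by
    refine Measure.restrict_congr_set ?_
    filter_upwards [hμ.ae_mem_Icc] with y hy
    refine propext (iff_self_and.2 fun _ => ⟨by linarith [hy.1], by linarith [hy.2]⟩)
  have hle : ∫ y in (Ioo (t - δ) (t + δ))ᶜ, ((t - y) ^ 2)⁻¹ ∂μ
      ≤ ∫ y in (Ioo (t - δ) (t + δ))ᶜ ∩ Ioo A B, ((t - y) ^ 2)⁻¹ := by
    rw [hae]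
    refine integral_mono_measure (Measure.restrict_mono subset_rfl hμ.le_volume)
      (ae_of_all _ fun y => by positivity) ?_
    exact integrableOn_inv_sub_pow hδ (hJm.inter measurableSet_Ioo)
      ((measure_mono inter_subset_right).trans_lt measure_Ioo_lt_top).ne inter_subset_left 2
  rw [setIntegral_truncated_two (t := t) hδ (by linarith : A ≤ B),
    truncInv_of_le hδ (by linarith : A ≤ t - δ),
    truncInv_of_ge hδ (by linarith : t + δ ≤ B)] at hle
  have h1 : 0 < (t - A)⁻¹ := inv_pos.2 (by linarith)
  have h2 : 0 < (B - t)⁻¹ := inv_pos.2 (by linarith)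
  linarith

/-- Now E < 0 < D, so c - t = (E - 1)/(E D) > 0 and d - t = E (c - t) < 0: t is strictly between d
and c, and logarithms are taken of -E. -/
lemma edge_full (hμ : IsLimitMeasure μ a b x) (ht : t ∈ Rco μ) (hI : AdmCo μ t (I t)) :
    (edge μ a b I t).2 < 1 ∧
    t ∈ Ioo ((edge μ a b I t).1 + (edge μ a b I t).2 - 1) (edge μ a b I t).1 ∧
    t ∉ (posPart μ (edge μ a b I t)).support ∧ t ∉ (negPart μ (edge μ a b I t)).support ∧
    mom (posPart μ (edge μ a b I t)) (negPart μ (edge μ a b I t)) t 1 = 0 ∧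
    mom (posPart μ (edge μ a b I t)) (negPart μ (edge μ a b I t)) t 2 = 0 := by
  have htμ : ¬ t ∉ μ.support := fun h => ht (hμ.mem_support_co h)
  obtain ⟨htI, hsub⟩ := hI
  have hJ := measure_Ioo_eq_zero_of_subset hsub
  have hexp : expC μ a b I t
      = Real.exp (CI μ a b (I t) t) * ((t - (I t).1) / (t - (I t).2)) := by
    rw [expC, if_neg htμ]
  have hder : derC μ a b I t = -(∫ y in (Ioo (I t).1 (I t).2)ᶜ, ((t - y) ^ 2)⁻¹ ∂μ)
      - 1 / (t - (I t).2) + 1 / (t - (I t).1) := by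
    rw [derC, if_neg htμ, hμ.deriv_CI htI]
  have hS := hμ.integral_inv_sq_lt hJ htI
  obtain ⟨hc, hη⟩ := edge_of_off μ a b I (Or.inr ht)
  have hK := hμ.CI_eq (I t) t
  set p := edge μ a b I t
  set K := CI μ a b (I t) t
  set E := expC μ a b I t
  set D := derC μ a b I t
  set t₁ := (I t).2
  set t₂ := (I t).1
  have ht1 : 0 < t₁ - t := sub_pos.2 htI.2
  have ht2 : 0 < t - t₂ := sub_pos.2 htI.1
  have hder' : D = -(∫ y in (Ioo t₂ t₁)ᶜ, ((t - y) ^ 2)⁻¹ ∂μ) + (t₁ - t)⁻¹ + (t - t₂)⁻¹ := by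
    rw [hder, one_div, one_div, ← neg_sub t₁ t, inv_neg]
    ring
  have hnegE : -E = Real.exp K * ((t - t₂) / (t₁ - t)) := by
    rw [hexp, ← neg_sub t₁ t, div_neg]
    ring
  have hE : 0 < -E := hnegE ▸ mul_pos (Real.exp_pos _) (div_pos ht2 ht1)
  have hD : 0 < D := by linarith
  have hlogE : Real.log (-E) = K + (Real.log (t - t₂) - Real.log (t₁ - t)) := by
    rw [hnegE, Real.log_mul (Real.exp_pos _).ne' (div_pos ht2 ht1).ne', Real.log_exp,
      Real.log_div ht2.ne' ht1.ne']
  obtain ⟨hct, hdt, hrel⟩ := edge_ends (by linarith) hD.ne' hc hη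
  have hED : E * D < 0 := mul_neg_of_neg_of_pos (by linarith) hD
  have h1 : 0 < p.1 - t := hct ▸ div_pos_of_neg_of_neg (by linarith) hED
  have hdt' : t - (p.1 + p.2 - 1) = -E * (p.1 - t) := by linarith
  have h2 : 0 < t - (p.1 + p.2 - 1) := hdt' ▸ mul_pos hE h1
  have hp : p.2 < 1 := by linarith
  obtain ⟨δ, hδ, hδ1, hδ2, hδ3, hδ4⟩ := exists_pos_le_four ht2 ht1 h1 h2
  have hloc : LocalModel μ p t δ t₂ t₁ t₂ t₁ := by
    refine ⟨hδ, by linarith, by linarith, hμ.restrict_eq_of_full hJ, fun y hy => ?_⟩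
    exact iff_of_true ⟨by linarith [hy.1], by linarith [hy.2]⟩
      ⟨by linarith [hy.1], by linarith [hy.2]⟩
  refine ⟨hp, ⟨by linarith, by linarith⟩, hloc.notMem_posPart, hloc.notMem_negPart hμ, ?_, ?_⟩
  · rw [hloc.mom_one hμ hp.le (by linarith), truncLog_of_le hδ (by linarith : t₂ ≤ t - δ),
      truncLog_of_ge hδ (by linarith : t + δ ≤ t₁), truncLog_of_ge hδ (by linarith : t + δ ≤ p.1),
      truncLog_of_le hδ (by linarith : p.1 + p.2 - 1 ≤ t - δ), hdt',
      Real.log_mul hE.ne' h1.ne', hlogE, hK]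
    ring
  · rw [hloc.mom_two hμ hp.le (by linarith), truncInv_of_le hδ (by linarith : t₂ ≤ t - δ),
      truncInv_of_ge hδ (by linarith : t + δ ≤ t₁), truncInv_of_ge hδ (by linarith : t + δ ≤ p.1),
      truncInv_of_le hδ (by linarith : p.1 + p.2 - 1 ≤ t - δ), hdt',
      (by linarith : ∫ y in (Ioo t₂ t₁)ᶜ, ((t - y) ^ 2)⁻¹ ∂μ
        = (t₁ - t)⁻¹ + (t - t₂)⁻¹ - D)]
    have hE' : E ≠ 0 := by linarith
    have : D = (p.1 - t)⁻¹ + (-E * (p.1 - t))⁻¹ := by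
      field_simp
      linarith
    linarith

/-- C(t) = 0 means E = 1, so the formula collapses to (t, 1). Then (u, v) and (d, c) are both empty,
and the first moment is C(t). -/
lemma edge_zero (hμ : IsLimitMeasure μ a b x) (ht : t ∈ R0 μ a b) (I : ℝ → ℝ × ℝ) :
    edge μ a b I t = (t, 1) ∧
    t ∉ (posPart μ (t, 1)).support ∧ t ∉ (negPart μ (t, 1)).support ∧
    mom (posPart μ (t, 1)) (negPart μ (t, 1)) t 1 = 0 := by
  obtain ⟨htμ, hC⟩ := ht
  obtain ⟨⟨t₂, t₁⟩, htJ, hJ⟩ := (nhds_basis_Ioo t).notMem_measureSupport.1 htμ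
  rw [C_ofReal, Complex.ofReal_eq_zero] at hC
  have hexp : expC μ a b I t = 1 := by
    rw [expC, if_pos htμ, hC, Real.exp_zero]
  rw [realCauchyOn_eq_CI a b hJ, hμ.CI_eq] at hC
  obtain ⟨δ, hδ, hδ1, hδ2, -, -⟩ := exists_pos_le_four (sub_pos.2 htJ.1) (sub_pos.2 htJ.2)
    one_pos one_pos
  have hloc : LocalModel μ (t, 1) t δ t₂ t₁ t t :=
    ⟨hδ, by linarith, by linarith, restrict_eq_of_gap t hJ, fun y _ => by simp⟩
  refine ⟨?_, hloc.notMem_posPart, hloc.notMem_negPart hμ, ?_⟩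
  · rw [edge, if_pos (Or.inl htμ), hexp]
    simp
  · rw [hloc.mom_one hμ le_rfl le_rfl, hC]
    simp

/-- Near t the measure μ is Lebesgue to the left and zero to the right, just like (d, c) with c = t.
The first moment then vanishes exactly when t - d = e^{C_I(t)} (t - t₂). -/
lemma edge_right_gap (hμ : IsLimitMeasure μ a b x) (ht : t ∈ R1 μ) (hI : Adm1 μ t (I t)) :
    (edge μ a b I t).2 < 1 ∧ t = (edge μ a b I t).1 ∧
    t ∉ (posPart μ (edge μ a b I t)).support ∧ t ∉ (negPart μ (edge μ a b I t)).support ∧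
    mom (posPart μ (edge μ a b I t)) (negPart μ (edge μ a b I t)) t 1 = 0 := by
  have hedge : edge μ a b I t = (t, 1 - Real.exp (CI μ a b (I t) t) * (t - (I t).1)) := by
    rw [edge, if_neg, if_pos ht]
    rintro (h | h)
    · exact h (mem_support_of_mem_frontier ht.1.1)
    · exact h (mem_support_of_mem_frontier ht.1.2)
  have hK := hμ.CI_eq (I t) t
  have h1 : (edge μ a b I t).1 = t := by rw [hedge]
  have h2 : t - ((edge μ a b I t).1 + (edge μ a b I t).2 - 1)
      = Real.exp (CI μ a b (I t) t) * (t - (I t).1) := by rw [hedge]; ring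
  have hres := hμ.restrict_eq_of_adm1 hI
  obtain ⟨htI, -, -⟩ := hI
  set p := edge μ a b I t
  set K := CI μ a b (I t) t
  set t₁ := (I t).2
  set t₂ := (I t).1
  have ht1 : 0 < t₁ - t := sub_pos.2 htI.2
  have ht2 : 0 < t - t₂ := sub_pos.2 htI.1
  have h3 : 0 < t - (p.1 + p.2 - 1) := h2 ▸ mul_pos (Real.exp_pos _) ht2
  have hp : p.2 < 1 := by linarith
  obtain ⟨δ, hδ, hδ1, hδ2, hδ3, -⟩ := exists_pos_le_four ht2 ht1 h3 one_pos
  have hloc : LocalModel μ p t δ t₂ t₁ t₂ t := by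
    refine ⟨hδ, by linarith, by linarith, hres, fun y hy => ?_⟩
    rw [h1] at hδ3 ⊢
    exact ⟨fun h => ⟨by linarith [hy.1], h.2⟩, fun h => ⟨by linarith [hy.1], h.2⟩⟩
  refine ⟨hp, h1.symm, hloc.notMem_posPart, hloc.notMem_negPart hμ, ?_⟩
  -- The two values of `truncLog` at t, from v and from c, are equal and cancel.
  rw [hloc.mom_one hμ hp.le (by linarith), truncLog_of_le hδ (by linarith : t₂ ≤ t - δ),
    truncLog_of_le hδ (by linarith : p.1 + p.2 - 1 ≤ t - δ), h1,
    (by rw [h1] at h2; exact h2 : t - (t + p.2 - 1) = Real.exp K * (t - t₂)),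
    Real.log_mul (Real.exp_pos _).ne' ht2.ne', Real.log_exp, hK]
  ring

lemma edge_left_gap (hμ : IsLimitMeasure μ a b x) (ht : t ∈ R2 μ) (hI : Adm2 μ t (I t)) :
    (edge μ a b I t).2 < 1 ∧ t = (edge μ a b I t).1 + (edge μ a b I t).2 - 1 ∧
    t ∉ (posPart μ (edge μ a b I t)).support ∧ t ∉ (negPart μ (edge μ a b I t)).support ∧
    mom (posPart μ (edge μ a b I t)) (negPart μ (edge μ a b I t)) t 1 = 0 := by
  have htμ := mem_support_of_mem_frontier ht.1.1
  have hedge : edge μ a b I t = (t - Real.exp (-CI μ a b (I t) t) * (t - (I t).2),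
      1 + Real.exp (-CI μ a b (I t) t) * (t - (I t).2)) := by
    -- The third branch of `edge` is reached only because R_1 and R_2 are disjoint.
    rw [edge, if_neg, if_neg, if_pos ht]
    · rintro ⟨-, J, hJ⟩
      exact hμ.not_adm_both hJ hI htμ
    · rintro (h | h)
      · exact h htμ
      · exact h (mem_support_of_mem_frontier ht.1.2)
  have hK := hμ.CI_eq (I t) t
  have h1 : (edge μ a b I t).1 + (edge μ a b I t).2 - 1 = t := by rw [hedge]; ring
  have h2 : (edge μ a b I t).1 - t = Real.exp (-CI μ a b (I t) t) * ((I t).2 - t) := by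
    rw [hedge]; ring
  have hres := hμ.restrict_eq_of_adm2 hI
  obtain ⟨htI, -, -⟩ := hI
  set p := edge μ a b I t
  set K := CI μ a b (I t) t
  set t₁ := (I t).2
  set t₂ := (I t).1
  have ht1 : 0 < t₁ - t := sub_pos.2 htI.2
  have ht2 : 0 < t - t₂ := sub_pos.2 htI.1
  have h3 : 0 < p.1 - t := h2 ▸ mul_pos (Real.exp_pos _) ht1
  have hp : p.2 < 1 := by linarith
  obtain ⟨δ, hδ, hδ1, hδ2, hδ3, -⟩ := exists_pos_le_four ht2 ht1 h3 one_pos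
  have hloc : LocalModel μ p t δ t₂ t₁ t t₁ := by
    refine ⟨hδ, by linarith, by linarith, hres, fun y hy => ?_⟩
    rw [h1]
    exact ⟨fun h => ⟨h.1, by linarith [hy.2]⟩, fun h => ⟨h.1, by linarith [hy.2]⟩⟩
  refine ⟨hp, h1.symm, hloc.notMem_posPart, hloc.notMem_negPart hμ, ?_⟩
  rw [hloc.mom_one hμ hp.le (by linarith), h1, truncLog_of_ge hδ (by linarith : t + δ ≤ t₁),
    truncLog_of_ge hδ (by linarith : t + δ ≤ p.1), h2,
    Real.log_mul (Real.exp_pos _).ne' ht1.ne', Real.log_exp, hK]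
  ring

end IsLimitMeasure

end

/-! ### Multiplicities and the case η = 1 -/

section

variable {μ : Measure ℝ} [IsProbabilityMeasure μ] {a b : ℝ} {x : (n : ℕ) → Fin n → ℤ}
  {p : ℝ × ℝ} {t : ℝ}

namespace IsLimitMeasure

lemma isRootOfMult_two_or_three (hμ : IsLimitMeasure μ a b x) (hp : p.2 ≤ 1)
    (h : IsCritical (posPart μ p) (negPart μ p) p.1 (p.1 + p.2 - 1) t)
    (h2 : mom (posPart μ p) (negPart μ p) t 2 = 0) :
    IsRootOfMult μ a b p t 2 ∨ IsRootOfMult μ a b p t 3 := by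
  obtain ⟨j, hj1, hj2, hj⟩ := hμ.isRootOfMult_or hp h (n := 2) (m := 4)
    (fun k hk => by interval_cases k; exacts [h.mom_one, h2])
    (fun hall => (hμ.signPair hp).not_higher_moments h.offP h.offN h2
      (by rw [hall 2 (by norm_num), mul_zero]) (by rw [hall 3 (by norm_num), mul_zero]))
  interval_cases j
  exacts [Or.inl hj, Or.inr hj]

/-- At an endpoint the fourth moment enters with coefficient zero, so the second and third moments
cannot both vanish. -/
lemma isRootOfMult_one_or_two (hμ : IsLimitMeasure μ a b x) (hp : p.2 ≤ 1)
    (h : IsCritical (posPart μ p) (negPart μ p) p.1 (p.1 + p.2 - 1) t)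
    (ht : (t - p.1) * (t - (p.1 + p.2 - 1)) = 0) :
    IsRootOfMult μ a b p t 1 ∨ IsRootOfMult μ a b p t 2 := by
  obtain ⟨j, hj1, hj2, hj⟩ := hμ.isRootOfMult_or hp h (n := 1) (m := 3)
    (fun k hk => by interval_cases k; exact h.mom_one)
    (fun hall => (hμ.signPair hp).not_higher_moments h.offP h.offN (hall 1 (by norm_num))
      (by rw [hall 2 (by norm_num), mul_zero]) (by rw [ht, zero_mul]))
  interval_cases j
  exacts [Or.inl hj, Or.inr hj]

/-- With c = d = t the coefficients of the third and fourth moments are both zero, so the second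
moment cannot vanish. -/
lemma isRootOfMult_one (hμ : IsLimitMeasure μ a b x)
    (h : IsCritical (posPart μ (t, 1)) (negPart μ (t, 1)) t (t + 1 - 1) t) :
    IsRootOfMult μ a b (t, 1) t 1 := by
  obtain ⟨j, hj1, hj2, hj⟩ := hμ.isRootOfMult_or (p := (t, 1)) le_rfl h (n := 1) (m := 2)
    (fun k hk => by interval_cases k; exact h.mom_one)
    (fun hall => (hμ.signPair (p := (t, 1)) le_rfl).not_higher_moments h.offP h.offN
      (hall 1 (by norm_num)) (by simp only; ring) (by simp only; ring))
  interval_cases j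
  exact hj

lemma posPart_top (μ : Measure ℝ) (t : ℝ) : posPart μ (t, 1) = μ := by simp [posPart]

lemma negPart_top (μ : Measure ℝ) (t : ℝ) : negPart μ (t, 1) = 0 := by simp [negPart]

lemma singSet_top (hμ : IsLimitMeasure μ a b x) (t : ℝ) :
    singSet μ a b (t, 1) = μ.support := by
  rw [hμ.singSet_eq, posPart_top, negPart_top, Measure.support_zero, union_empty]

lemma fDer_top (hμ : IsLimitMeasure μ a b x) (t : ℝ) {w : ℂ}
    (hw : w ∉ Complex.ofReal '' μ.support) : fDer μ a b (t, 1) w = C μ a b w := by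
  have hres : μ.restrict (Icc a b) = μ := Measure.restrict_eq_self_of_ae_mem hμ.ae_mem_Icc
  rw [hμ.fDer_eq (p := (t, 1)) le_rfl (by rwa [posPart_top]), posPart_top, negPart_top, C, cauchyOn,
    hres]
  simp

end IsLimitMeasure

end

end GTEdge

/-! ### Assembly -/

theorem mainTheorem10 (μ : MeasureTheory.Measure ℝ) [MeasureTheory.IsProbabilityMeasure μ]
    (a b : ℝ) (x : (n : ℕ) → Fin n → ℤ) (hμ : GTEdge.IsLimitMeasure μ a b x)
    (I : ℝ → ℝ × ℝ) (hI : GTEdge.AdmissibleChoice μ I)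
    (t : ℝ) (ht : t ∈ GTEdge.R μ a b) :
    -- (a)
    ((GTEdge.edge μ a b I t ∈ GTEdge.Emu μ a b ↔ t ∈ GTEdge.Rmu μ a b) ∧
      (t ∈ GTEdge.Rmu μ a b →
        GTEdge.IsRootOfMult μ a b (GTEdge.edge μ a b I t) t 2 ∨
        GTEdge.IsRootOfMult μ a b (GTEdge.edge μ a b I t) t 3)) ∧
    -- (b)
    ((GTEdge.edge μ a b I t ∈ GTEdge.Eco μ a b ↔ t ∈ GTEdge.Rco μ) ∧
      (t ∈ GTEdge.Rco μ →
        GTEdge.IsRootOfMult μ a b (GTEdge.edge μ a b I t) t 2 ∨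
        GTEdge.IsRootOfMult μ a b (GTEdge.edge μ a b I t) t 3)) ∧
    -- (c)
    ((GTEdge.edge μ a b I t ∈ GTEdge.E0 μ a b ↔ t ∈ GTEdge.R0 μ a b) ∧
      (t ∈ GTEdge.R0 μ a b →
        GTEdge.singSet μ a b (GTEdge.edge μ a b I t) = μ.support ∧
        (∀ w : ℂ, w ∉ Complex.ofReal '' μ.support →
          GTEdge.fDer μ a b (GTEdge.edge μ a b I t) w = GTEdge.C μ a b w) ∧
        GTEdge.IsRootOfMult μ a b (GTEdge.edge μ a b I t) t 1)) ∧
    -- (d)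
    ((GTEdge.edge μ a b I t ∈ GTEdge.E1 μ a b ↔ t ∈ GTEdge.R1 μ) ∧
      (t ∈ GTEdge.R1 μ →
        GTEdge.IsRootOfMult μ a b (GTEdge.edge μ a b I t) t 1 ∨
        GTEdge.IsRootOfMult μ a b (GTEdge.edge μ a b I t) t 2)) ∧
    -- (e)
    ((GTEdge.edge μ a b I t ∈ GTEdge.E2 μ a b ↔ t ∈ GTEdge.R2 μ) ∧
      (t ∈ GTEdge.R2 μ →
        GTEdge.IsRootOfMult μ a b (GTEdge.edge μ a b I t) t 1 ∨
        GTEdge.IsRootOfMult μ a b (GTEdge.edge μ a b I t) t 2)) := by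
  -- The five parts of R are pairwise disjoint, so the critical point's position for t in one part
  -- settles all five equivalences.
  have hR1s : t ∈ GTEdge.R1 μ → t ∈ μ.support ∧ t ∈ (GTEdge.co μ).support := fun h =>
    ⟨GTEdge.mem_support_of_mem_frontier h.1.1,
      GTEdge.mem_support_of_mem_frontier h.1.2⟩
  have hR2s : t ∈ GTEdge.R2 μ → t ∈ μ.support ∧ t ∈ (GTEdge.co μ).support := fun h =>
    ⟨GTEdge.mem_support_of_mem_frontier h.1.1,
      GTEdge.mem_support_of_mem_frontier h.1.2⟩
  have hmuco : t ∈ GTEdge.Rmu μ a b → t ∉ GTEdge.Rco μ := fun h h' => h' (hμ.mem_support_co h.1)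
  have hmu0 : t ∈ GTEdge.Rmu μ a b → t ∉ GTEdge.R0 μ a b := fun h h' => h.2 h'.2
  have hmu1 : t ∈ GTEdge.Rmu μ a b → t ∉ GTEdge.R1 μ := fun h h' => h.1 (hR1s h').1
  have hmu2 : t ∈ GTEdge.Rmu μ a b → t ∉ GTEdge.R2 μ := fun h h' => h.1 (hR2s h').1
  have hco0 : t ∈ GTEdge.Rco μ → t ∉ GTEdge.R0 μ a b := fun h h' => h (hμ.mem_support_co h'.1)
  have hco1 : t ∈ GTEdge.Rco μ → t ∉ GTEdge.R1 μ := fun h h' => h (hR1s h').2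
  have hco2 : t ∈ GTEdge.Rco μ → t ∉ GTEdge.R2 μ := fun h h' => h (hR2s h').2
  have h01 : t ∈ GTEdge.R0 μ a b → t ∉ GTEdge.R1 μ := fun h h' => h.1 (hR1s h').1
  have h02 : t ∈ GTEdge.R0 μ a b → t ∉ GTEdge.R2 μ := fun h h' => h.1 (hR2s h').1
  have h12 : t ∈ GTEdge.R1 μ → t ∉ GTEdge.R2 μ := fun h h' =>
    hμ.not_adm_both (hI.2.1 t h) (hI.2.2 t h') (hR1s h).1
  rcases ht with (((ht | ht) | ht) | ht) | ht
  · obtain ⟨hp, hloc, hP, hN, h1, h2⟩ := hμ.edge_gap ht I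
    have hcrit : GTEdge.IsCritical (GTEdge.posPart μ (GTEdge.edge μ a b I t)) (GTEdge.negPart μ (GTEdge.edge μ a b I t))
        (GTEdge.edge μ a b I t).1 ((GTEdge.edge μ a b I t).1 + (GTEdge.edge μ a b I t).2 - 1) t :=
      ⟨hP, hN, h1, by rw [h2, mul_zero]⟩
    obtain ⟨e1, e2, e3, e4, e5⟩ := hμ.mem_edge_sets_iff (hμ.shape_of_isCritical hp hcrit
      (Or.inr (by rw [h2, mul_zero])) (Or.inr (by rw [h2, mul_zero]))) hcrit
    have hne1 : t ≠ (GTEdge.edge μ a b I t).1 := fun h => hloc ⟨by linarith, h.le⟩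
    have hne2 : t ≠ (GTEdge.edge μ a b I t).1 + (GTEdge.edge μ a b I t).2 - 1 := fun h =>
      hloc ⟨h.ge, by linarith⟩
    have hnI : t ∉ Set.Ioo ((GTEdge.edge μ a b I t).1 + (GTEdge.edge μ a b I t).2 - 1) (GTEdge.edge μ a b I t).1 :=
      fun h => hloc (Set.Ioo_subset_Icc_self h)
    have hmult := hμ.isRootOfMult_two_or_three hp hcrit h2
    exact ⟨⟨iff_of_true (e1.2 hloc) ht, fun _ => hmult⟩,
      ⟨iff_of_false (mt e2.1 hnI) (hmuco ht), fun h => absurd h (hmuco ht)⟩,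
      ⟨iff_of_false (fun h => hne1 (e3.1 h).2) (hmu0 ht), fun h => absurd h (hmu0 ht)⟩,
      ⟨iff_of_false (fun h => hne1 (e4.1 h).2) (hmu1 ht), fun h => absurd h (hmu1 ht)⟩,
      ⟨iff_of_false (fun h => hne2 (e5.1 h).2) (hmu2 ht), fun h => absurd h (hmu2 ht)⟩⟩
  · obtain ⟨hp, hloc, hP, hN, h1, h2⟩ := hμ.edge_full ht (hI.1 t ht)
    have hcrit : GTEdge.IsCritical (GTEdge.posPart μ (GTEdge.edge μ a b I t)) (GTEdge.negPart μ (GTEdge.edge μ a b I t))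
        (GTEdge.edge μ a b I t).1 ((GTEdge.edge μ a b I t).1 + (GTEdge.edge μ a b I t).2 - 1) t :=
      ⟨hP, hN, h1, by rw [h2, mul_zero]⟩
    obtain ⟨e1, e2, e3, e4, e5⟩ := hμ.mem_edge_sets_iff (hμ.shape_of_isCritical hp.le hcrit
      (Or.inr (by rw [h2, mul_zero])) (Or.inr (by rw [h2, mul_zero]))) hcrit
    have hne1 : t ≠ (GTEdge.edge μ a b I t).1 := hloc.2.ne
    have hne2 : t ≠ (GTEdge.edge μ a b I t).1 + (GTEdge.edge μ a b I t).2 - 1 := hloc.1.ne'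
    have hI' := Set.Ioo_subset_Icc_self hloc
    have hmult := hμ.isRootOfMult_two_or_three hp.le hcrit h2
    exact ⟨⟨iff_of_false (fun h => e1.1 h hI') (fun h => hmuco h ht), fun h => absurd h (fun h => hmuco h ht)⟩,
      ⟨iff_of_true (e2.2 hloc) ht, fun _ => hmult⟩,
      ⟨iff_of_false (fun h => hne1 (e3.1 h).2) (hco0 ht), fun h => absurd h (hco0 ht)⟩,
      ⟨iff_of_false (fun h => hne1 (e4.1 h).2) (hco1 ht), fun h => absurd h (hco1 ht)⟩,
      ⟨iff_of_false (fun h => hne2 (e5.1 h).2) (hco2 ht), fun h => absurd h (hco2 ht)⟩⟩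
  · obtain ⟨hedge, hP, hN, h1⟩ := hμ.edge_zero ht I
    have hcrit : GTEdge.IsCritical (GTEdge.posPart μ (t, 1)) (GTEdge.negPart μ (t, 1)) t (t + 1 - 1) t :=
      ⟨hP, hN, h1, by ring⟩
    rw [hedge]
    obtain ⟨e1, e2, e3, e4, e5⟩ := hμ.mem_edge_sets_iff (p := (t, 1))
      (hμ.shape_of_isCritical (p := (t, 1)) le_rfl hcrit (Or.inr (by simp only; ring))
        (Or.inr (by simp only; ring))) hcrit
    simp only [add_sub_cancel_right, Set.Icc_self, Set.mem_singleton_iff, not_true, Set.Ioo_self,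
      Set.mem_empty_iff_false, lt_irrefl, false_and, and_self, iff_false, iff_true] at e1 e2 e3 e4 e5
    have hmult := hμ.isRootOfMult_one hcrit
    exact ⟨⟨iff_of_false (e1) (fun h => hmu0 h ht), fun h => absurd h (fun h => hmu0 h ht)⟩,
      ⟨iff_of_false (e2) (fun h => hco0 h ht), fun h => absurd h (fun h => hco0 h ht)⟩,
      ⟨iff_of_true (e3) ht, fun _ => ⟨hμ.singSet_top t, fun _ => hμ.fDer_top t, hmult⟩⟩,
      ⟨iff_of_false (e4) (h01 ht), fun h => absurd h (h01 ht)⟩,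
      ⟨iff_of_false (e5) (h02 ht), fun h => absurd h (h02 ht)⟩⟩
  · obtain ⟨hp, hloc, hP, hN, h1⟩ := hμ.edge_right_gap ht (hI.2.1 t ht)
    have h0 : t - (GTEdge.edge μ a b I t).1 = 0 := sub_eq_zero.2 hloc
    have hcrit : GTEdge.IsCritical (GTEdge.posPart μ (GTEdge.edge μ a b I t)) (GTEdge.negPart μ (GTEdge.edge μ a b I t))
        (GTEdge.edge μ a b I t).1 ((GTEdge.edge μ a b I t).1 + (GTEdge.edge μ a b I t).2 - 1) t :=
      ⟨hP, hN, h1, by rw [h0]; ring⟩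
    -- Since t = c, the linear factor gives a ≤ d, while c ≤ b holds because t is in the support of
    -- μ.
    obtain ⟨e1, e2, e3, e4, e5⟩ := hμ.mem_edge_sets_iff (hμ.shape_of_isCritical hp.le hcrit
      (Or.inr (by rw [h0, zero_mul])) (Or.inl ⟨(hR1s ht).1, hloc⟩)) hcrit
    have hne2 : t ≠ (GTEdge.edge μ a b I t).1 + (GTEdge.edge μ a b I t).2 - 1 := by linarith
    have hne0 := hp.ne
    have hnI : t ∉ Set.Ioo ((GTEdge.edge μ a b I t).1 + (GTEdge.edge μ a b I t).2 - 1) (GTEdge.edge μ a b I t).1 :=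
      fun h => h.2.ne hloc
    have hI' : t ∈ Set.Icc ((GTEdge.edge μ a b I t).1 + (GTEdge.edge μ a b I t).2 - 1) (GTEdge.edge μ a b I t).1 :=
      ⟨by linarith, hloc.le⟩
    have hmult := hμ.isRootOfMult_one_or_two hp.le hcrit (by rw [h0, zero_mul])
    exact ⟨⟨iff_of_false (fun h => e1.1 h hI') (fun h => hmu1 h ht), fun h => absurd h (fun h => hmu1 h ht)⟩,
      ⟨iff_of_false (mt e2.1 hnI) (fun h => hco1 h ht), fun h => absurd h (fun h => hco1 h ht)⟩,
      ⟨iff_of_false (fun h => hne0 (e3.1 h).1) (fun h => h01 h ht), fun h => absurd h (fun h => h01 h ht)⟩,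
      ⟨iff_of_true (e4.2 ⟨hp, hloc⟩) ht, fun _ => hmult⟩,
      ⟨iff_of_false (fun h => hne2 (e5.1 h).2) (h12 ht), fun h => absurd h (h12 ht)⟩⟩
  · obtain ⟨hp, hloc, hP, hN, h1⟩ := hμ.edge_left_gap ht (hI.2.2 t ht)
    have h0 : t - ((GTEdge.edge μ a b I t).1 + (GTEdge.edge μ a b I t).2 - 1) = 0 := sub_eq_zero.2 hloc
    have hcrit : GTEdge.IsCritical (GTEdge.posPart μ (GTEdge.edge μ a b I t)) (GTEdge.negPart μ (GTEdge.edge μ a b I t))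
        (GTEdge.edge μ a b I t).1 ((GTEdge.edge μ a b I t).1 + (GTEdge.edge μ a b I t).2 - 1) t :=
      ⟨hP, hN, h1, by rw [h0]; ring⟩
    obtain ⟨e1, e2, e3, e4, e5⟩ := hμ.mem_edge_sets_iff (hμ.shape_of_isCritical hp.le hcrit
      (Or.inl ⟨(hR2s ht).1, hloc⟩) (Or.inr (by rw [h0, zero_mul]))) hcrit
    have hne1 : t ≠ (GTEdge.edge μ a b I t).1 := by linarith
    have hne0 := hp.ne
    have hnI : t ∉ Set.Ioo ((GTEdge.edge μ a b I t).1 + (GTEdge.edge μ a b I t).2 - 1) (GTEdge.edge μ a b I t).1 :=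
      fun h => h.1.ne' hloc
    have hI' : t ∈ Set.Icc ((GTEdge.edge μ a b I t).1 + (GTEdge.edge μ a b I t).2 - 1) (GTEdge.edge μ a b I t).1 :=
      ⟨hloc.ge, by linarith⟩
    have hmult := hμ.isRootOfMult_one_or_two hp.le hcrit (by rw [h0, mul_zero])
    exact ⟨⟨iff_of_false (fun h => e1.1 h hI') (fun h => hmu2 h ht), fun h => absurd h (fun h => hmu2 h ht)⟩,
      ⟨iff_of_false (mt e2.1 hnI) (fun h => hco2 h ht), fun h => absurd h (fun h => hco2 h ht)⟩,
      ⟨iff_of_false (fun h => hne0 (e3.1 h).1) (fun h => h02 h ht), fun h => absurd h (fun h => h02 h ht)⟩,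
      ⟨iff_of_false (fun h => hne1 (e4.1 h).2) (fun h => h12 h ht), fun h => absurd h (fun h => h12 h ht)⟩,
      ⟨iff_of_true (e5.2 ⟨hp, hloc⟩) ht, fun _ => hmult⟩⟩
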